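/- Let $\{c_k\}_{k=1}^{\infty}$ be a nonincreasing sequence of nonnegative real numbers. (a) Let $\alpha$ be an even positive integer. If the series $\sum_{k=1}^{\infty} c_k\sin(k^{\alpha}x)$ converges at the point $x=\frac{\pi}{2}$ or at the point $x=\frac{2\pi}{3}$, then $\sum_{k=1}^{\infty}c_k<\infty$. (b) Let $\alpha$ be an odd positive integer and let $f$ be a polynomial of degree $\alpha$ with rational coefficients which contains only odd powers of the variable. If $c_kk\to 0$ as $k\to\infty$, then the series $\sum_{k=1}^{\infty}c_k\sin(f(k)x)$ converges uniformly in $x\in\mathbb{R}$. (c) Let $\alpha\in(0,2)$ be a real number. If $c_kk\to 0$ as $k\to\infty$, then the series $\sum_{k=1}^{\infty}c_k\sin(k^{\alpha}x)$ converges uniformly on every bounded subset of $\mathbb{R}$. -/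

import Mathlib

/-- The series `∑_{k ≥ 1} a k` converges: its partial sums `a 1 + ⋯ + a N` have a (finite) limit.
Convergence is not required to be absolute. -/
def SeriesConverges (a : ℕ → ℝ) : Prop :=
  ∃ s : ℝ, Filter.Tendsto (fun N : ℕ => ∑ k ∈ Finset.Icc 1 N, a k) Filter.atTop (nhds s)

/-- The series of functions `∑_{k ≥ 1} u k` converges uniformly on the set `S`: its partial sums
`u 1 + ⋯ + u N` tend to some function uniformly on `S`. -/
def SeriesConvergesUniformlyOn (u : ℕ → ℝ → ℝ) (S : Set ℝ) : Prop :=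
  ∃ g : ℝ → ℝ, TendstoUniformlyOn (fun (N : ℕ) (x : ℝ) => ∑ k ∈ Finset.Icc 1 N, u k x) g
    Filter.atTop S

open Finset Filter Topology

/-! For (a), an even exponent makes `k ^ α` congruent to 0 or 1 modulo 4 and modulo 3, so at the two
points the sines are nonnegative, and bounded below except when `k` is a multiple of 2 (resp. 3).
Each such exceptional coefficient is at most its predecessor, whose sine is not small, so the
partial sums of `c` are bounded (`seriesConverges_of_weighted`).

For (b) and (c), cut the series into blocks `[4 ^ j, 4 ^ (j + 1))`. Abel summation bounds a block by
`c (4 ^ j)` times the largest partial sum of sines in it. If that sum is at most `4 ^ j * T j`, the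
block costs at most `ε * T j` once `c k * k < ε`. Hence it suffices that `∑ T j` be bounded
uniformly in `x` (`seriesConvergesUniformlyOn_of_blocks`); the individual `T j` need not be
uniformly small. The typical `T j` is `min (ρ ^ j * t) (1 / (ρ ^ j * t))`: the first entry comes
from `|sin u| ≤ |u|`, the second from the Kusmin–Landau inequality, and the sum over `j` is bounded
independently of `t`.

In (b) the degree-one case is of this kind. For degree `d ≥ 3`, clear denominators and approximate
`y` at each scale by a fraction `r` with denominator `q`. If `q` is large, Weyl's inequality saves a
power of the block length. If `q` is small, the sine sum is close to `G / q` times the sine sum at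
`β = y - r`, where `G` is a complete sum. Since the polynomial is odd, `G` is real, so no cosine sum
enters. Weyl's inequality also gives `|G| / q ≪ q ^ (-δ)`. One `r` may serve many scales, at bounded
total cost times `q ^ (-δ)`, and distinct `r` have denominators growing at least by doubling
(`two_mul_den_le`), so these costs form a convergent geometric series.

In (c) the case `α = 1` is linear. Otherwise Kusmin–Landau handles scales at which the phase `θ * n
^ α` has small increments. Larger increments occur at large scales only for `α > 1`; there one Weyl
differencing on short pieces saves a power of the length. -/

namespace ExpSum

/-! ### Convergence criteria for series with monotone coefficients -/

/-- If `c` is nonincreasing and `2 s k ≥ 1` except at multiples of `p ≥ 2`, then convergence of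
`∑ c k * s k` with `s ≥ 0` forces convergence of `∑ c k`. -/
theorem seriesConverges_of_weighted {c s : ℕ → ℝ} (hc0 : ∀ k : ℕ, 1 ≤ k → 0 ≤ c k)
    (hc : AntitoneOn c (Set.Ici 1)) {p : ℕ} (hp : 2 ≤ p) (hs0 : ∀ k, 0 ≤ s k)
    (hs : ∀ k, ¬ p ∣ k → 1 ≤ 2 * s k) (h : SeriesConverges (fun k => c k * s k)) :
    SeriesConverges c := by
  obtain ⟨l, hl⟩ := h
  have hmono : Monotone (fun N : ℕ => ∑ k ∈ Icc 1 N, c k * s k) := by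
    refine monotone_nat_of_le_succ fun N => ?_
    rw [sum_Icc_succ_top (by omega)]
    have := mul_nonneg (hc0 (N + 1) (by omega)) (hs0 (N + 1))
    linarith
  have hle : ∀ N, ∑ k ∈ Icc 1 N, c k * s k ≤ l := fun N => hmono.ge_of_tendsto hl N
  have hd : ∀ k, 1 ≤ k → ¬ p ∣ k → c k ≤ 2 * (c k * s k) := by
    intro k hk hpk
    nlinarith [hs k hpk, hc0 k hk]
  -- Each weighted term is charged at most twice with factor 2: for its own index and for its
  -- successor. The subtracted term is the charge of the last index that its successor has not yet
  -- used.
  have hbound : ∀ N, ∑ k ∈ Icc 1 (N + 1), c k ≤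
      4 * ∑ k ∈ Icc 1 (N + 1), c k * s k - 2 * (c (N + 1) * s (N + 1)) := by
    intro N
    induction N with
    | zero =>
      have := hd 1 le_rfl (by intro h; have := Nat.le_of_dvd one_pos h; omega)
      simp only [zero_add, Icc_self, sum_singleton]
      linarith
    | succ N ih =>
      rw [sum_Icc_succ_top (by omega), sum_Icc_succ_top (b := N + 1) (by omega)]
      have key : c (N + 1 + 1) ≤
          2 * (c (N + 1 + 1) * s (N + 1 + 1)) + 2 * (c (N + 1) * s (N + 1)) := by
        have h1 := mul_nonneg (hc0 (N + 1) (by omega)) (hs0 (N + 1))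
        have h2 := mul_nonneg (hc0 (N + 1 + 1) (by omega)) (hs0 (N + 1 + 1))
        by_cases hdvd : p ∣ N + 1 + 1
        · have hnd : ¬ p ∣ N + 1 := by
            intro h'
            have := (Nat.dvd_add_right h').1 hdvd
            have := Nat.le_of_dvd one_pos this
            omega
          have h3 := hd (N + 1) (by omega) hnd
          have h4 : c (N + 1 + 1) ≤ c (N + 1) :=
            hc (Set.mem_Ici.2 (by omega)) (Set.mem_Ici.2 (by omega)) (by omega)
          linarith
        · have := hd (N + 1 + 1) (by omega) hdvd
          linarith
      linarith
  have hcm : Monotone (fun N : ℕ => ∑ k ∈ Icc 1 N, c k) := by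
    refine monotone_nat_of_le_succ fun N => ?_
    rw [sum_Icc_succ_top (by omega)]
    have := hc0 (N + 1) (by omega)
    linarith
  refine ⟨_, tendsto_atTop_ciSup hcm ⟨4 * l, ?_⟩⟩
  rintro _ ⟨N, rfl⟩
  have h1 := hcm (Nat.le_succ N)
  have h2 := hbound N
  have h3 := hle (N + 1)
  have h4 := mul_nonneg (hc0 (N + 1) (by omega)) (hs0 (N + 1))
  simp only [Nat.succ_eq_add_one] at h1 ⊢
  linarith

/-- An odd square is 1 modulo 4, so evenness of the exponent excludes the value -1; the same happens
modulo 3 in `sin_pow_mul_two_pi_div_three`. -/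
theorem sin_pow_mul_pi_div_two {α : ℕ} (hα : 0 < α) (hev : Even α) (k : ℕ) :
    Real.sin ((k : ℝ) ^ α * (Real.pi / 2)) = if 2 ∣ k then 0 else 1 := by
  obtain ⟨b, rfl⟩ := hev
  split_ifs with h
  · obtain ⟨m, rfl⟩ := h
    obtain ⟨b, rfl⟩ : ∃ e, b = e + 1 := ⟨b - 1, by omega⟩
    have : (((2 * m : ℕ) : ℝ)) ^ (b + 1 + (b + 1)) * (Real.pi / 2)
        = ((2 * (2 * m) ^ (b + b) * m ^ 2 : ℕ) : ℝ) * Real.pi := by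
      push_cast; ring
    rw [this, Real.sin_nat_mul_pi]
  · have hmod : k ^ (b + b) % 4 = 1 := by
      have h2 : k ^ 2 % 4 = 1 := by
        rcases (by omega : k % 4 = 1 ∨ k % 4 = 3) with h | h <;> simp [Nat.pow_mod, h]
      rw [← two_mul, pow_mul, Nat.pow_mod, h2]; simp
    obtain ⟨m, hm⟩ : ∃ m, k ^ (b + b) = 4 * m + 1 := ⟨k ^ (b + b) / 4, by omega⟩
    have : (k : ℝ) ^ (b + b) * (Real.pi / 2) = Real.pi / 2 + (m : ℝ) * (2 * Real.pi) := by
      rw [← Nat.cast_pow, hm]; push_cast; ring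
    rw [this, Real.sin_add_nat_mul_two_pi, Real.sin_pi_div_two]

theorem sin_pow_mul_two_pi_div_three {α : ℕ} (hα : 0 < α) (hev : Even α) (k : ℕ) :
    Real.sin ((k : ℝ) ^ α * (2 * Real.pi / 3)) = if 3 ∣ k then 0 else √3 / 2 := by
  obtain ⟨b, rfl⟩ := hev
  split_ifs with h
  · obtain ⟨m, rfl⟩ := h
    obtain ⟨b, rfl⟩ : ∃ e, b = e + 1 := ⟨b - 1, by omega⟩
    have : (((3 * m : ℕ) : ℝ)) ^ (b + 1 + (b + 1)) * (2 * Real.pi / 3)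
        = ((6 * (3 * m) ^ (b + b) * m ^ 2 : ℕ) : ℝ) * Real.pi := by
      push_cast; ring
    rw [this, Real.sin_nat_mul_pi]
  · have hmod : k ^ (b + b) % 3 = 1 := by
      have h2 : k ^ 2 % 3 = 1 := by
        rcases (by omega : k % 3 = 1 ∨ k % 3 = 2) with h | h <;> simp [Nat.pow_mod, h]
      rw [← two_mul, pow_mul, Nat.pow_mod, h2]; simp
    obtain ⟨m, hm⟩ : ∃ m, k ^ (b + b) = 3 * m + 1 := ⟨k ^ (b + b) / 3, by omega⟩
    have : (k : ℝ) ^ (b + b) * (2 * Real.pi / 3)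
        = (Real.pi - Real.pi / 3) + (m : ℝ) * (2 * Real.pi) := by
      rw [← Nat.cast_pow, hm]; push_cast; ring
    rw [this, Real.sin_add_nat_mul_two_pi, Real.sin_pi_sub, Real.sin_pi_div_three]

/-! ### Summation by parts, and uniform convergence from block bounds. -/

theorem norm_sum_mul_le {R : Type*} [NormedRing R] (w u : ℕ → R) {B : ℝ} (M : ℕ)
    (hB : ∀ m ≤ M, ‖∑ k ∈ range m, u k‖ ≤ B) :
    ‖∑ k ∈ range M, w k * u k‖ ≤
      B * (‖w (M - 1)‖ + ∑ k ∈ range (M - 1), ‖w (k + 1) - w k‖) := by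
  have h := sum_range_by_parts w u M
  simp only [smul_eq_mul] at h
  rw [h, mul_add, mul_sum (range (M - 1)) _ B]
  refine (norm_sub_le _ _).trans (add_le_add ?_ ((norm_sum_le _ _).trans (sum_le_sum ?_)))
  · rw [mul_comm B]
    exact (norm_mul_le _ _).trans (mul_le_mul_of_nonneg_left (hB M le_rfl) (norm_nonneg _))
  · intro k hk
    rw [mem_range] at hk
    rw [mul_comm B]
    exact (norm_mul_le _ _).trans
      (mul_le_mul_of_nonneg_left (hB (k + 1) (by omega)) (norm_nonneg _))

theorem sum_abs_sub_of_le {b : ℕ → ℝ} {n : ℕ} (hb : ∀ k < n, b k ≤ b (k + 1)) :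
    ∑ k ∈ range n, |b (k + 1) - b k| = b n - b 0 := by
  rw [← sum_range_sub]
  refine sum_congr rfl fun k hk => abs_of_nonneg ?_
  linarith [hb k (mem_range.1 hk)]

theorem sum_abs_sub_of_ge {b : ℕ → ℝ} {n : ℕ} (hb : ∀ k < n, b (k + 1) ≤ b k) :
    ∑ k ∈ range n, |b (k + 1) - b k| = b 0 - b n := by
  rw [← sum_range_sub']
  refine sum_congr rfl fun k hk => ?_
  rw [abs_sub_comm, abs_of_nonneg]
  linarith [hb k (mem_range.1 hk)]

/-- For a nonincreasing nonnegative weight, final value plus total variation telescopes to the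
initial value. -/
theorem abs_sum_mul_le_of_antitone {c u : ℕ → ℝ} {B : ℝ} {M : ℕ} (hc0 : ∀ k, 0 ≤ c k)
    (hc : ∀ k, c (k + 1) ≤ c k) (hB : ∀ m ≤ M, |∑ k ∈ range m, u k| ≤ B) :
    |∑ k ∈ range M, c k * u k| ≤ B * c 0 := by
  have h := norm_sum_mul_le c u M hB
  simp only [Real.norm_eq_abs] at h
  rw [sum_abs_sub_of_ge fun k _ => hc k, abs_of_nonneg (hc0 (M - 1))] at h
  simpa using h

/-- Uniform convergence from bounds for the dyadic-type blocks `[4 ^ j, 4 ^ (j + 1))` whose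
relative sizes `T j` have uniformly bounded sum. -/
theorem seriesConvergesUniformlyOn_of_blocks {c : ℕ → ℝ} (hc0 : ∀ k : ℕ, 1 ≤ k → 0 ≤ c k)
    (hc : AntitoneOn c (Set.Ici 1)) (hck : Tendsto (fun k : ℕ => c k * (k : ℝ)) atTop (𝓝 0))
    (u : ℕ → ℝ → ℝ) (S : Set ℝ) (j₀ : ℕ) (C : ℝ)
    (h : ∀ x ∈ S, ∃ T : ℕ → ℝ, (∀ j, 0 ≤ T j) ∧
      (∀ j, j₀ ≤ j → ∀ M, M ≤ 3 * 4 ^ j → |∑ k ∈ range M, u (4 ^ j + k) x| ≤ 4 ^ j * T j) ∧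
      ∀ J, ∑ j ∈ range J, T j ≤ C) :
    SeriesConvergesUniformlyOn (fun k x => c k * u k x) S := by
  have main : ∀ ε > 0, ∃ J : ℕ, ∀ n, 4 ^ J ≤ n → ∀ x ∈ S,
      |∑ k ∈ Ico (4 ^ J) n, c k * u k x| ≤ ε * C := by
    intro ε hε
    obtain ⟨K, hK⟩ := eventually_atTop.1 (hck.eventually (gt_mem_nhds hε))
    -- Every later block starts at some `4 ^ i > K`, so its first coefficient times its starting
    -- index is below `ε`.
    refine ⟨j₀ + K, fun n hn x hx => ?_⟩
    obtain ⟨T, hT0, hT, hTC⟩ := h x hx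
    have claim : ∀ j n, 4 ^ (j₀ + K) ≤ n → n ≤ 4 ^ (j₀ + K + j) →
        |∑ k ∈ Ico (4 ^ (j₀ + K)) n, c k * u k x| ≤ ε * ∑ i ∈ range (j₀ + K + j), T i := by
      intro j
      induction j with
      | zero =>
        intro n hn1 hn2
        have : n = 4 ^ (j₀ + K) := le_antisymm hn2 hn1
        subst this
        simpa using mul_nonneg hε.le (sum_nonneg fun i _ => hT0 i)
      | succ j ih =>
        intro n hn1 hn2
        rw [← add_assoc, sum_range_succ, mul_add]
        rcases le_total n (4 ^ (j₀ + K + j)) with hle | hge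
        · exact (ih n hn1 hle).trans (le_add_of_nonneg_right (mul_nonneg hε.le (hT0 _)))
        · have hle : 4 ^ (j₀ + K) ≤ 4 ^ (j₀ + K + j) := Nat.pow_le_pow_right (by norm_num) (by omega)
          rw [← sum_Ico_consecutive _ hle hge]
          refine (abs_add_le _ _).trans (add_le_add (ih _ hle le_rfl) ?_)
          rw [sum_Ico_eq_sum_range]
          have hpos : 1 ≤ 4 ^ (j₀ + K + j) := Nat.one_le_pow _ _ (by norm_num)
          have h1 := abs_sum_mul_le_of_antitone (c := fun k => c (4 ^ (j₀ + K + j) + k))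
            (u := fun k => u (4 ^ (j₀ + K + j) + k) x) (B := 4 ^ (j₀ + K + j) * T (j₀ + K + j))
            (M := n - 4 ^ (j₀ + K + j)) (fun k => hc0 _ (by omega))
            (fun k => hc (Set.mem_Ici.2 (by omega)) (Set.mem_Ici.2 (by omega)) (by omega))
            (fun m hm => hT _ (by omega) m (by
              rw [← add_assoc, pow_succ] at hn2
              omega))
          refine h1.trans ?_
          have h2 := hK (4 ^ (j₀ + K + j)) (by
            have := Nat.lt_pow_self (show 1 < 4 by norm_num) (n := j₀ + K + j)
            omega)
          push_cast at h2
          simp only [add_zero]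
          nlinarith [hT0 (j₀ + K + j)]
    have hb := claim n n hn (by
      have h1 := Nat.lt_pow_self (show 1 < 4 by norm_num) (n := j₀ + K + n)
      omega)
    exact hb.trans (mul_le_mul_of_nonneg_left (hTC _) hε.le)
  have hcauchy : UniformCauchySeqOn
      (fun (N : ℕ) (x : ℝ) => ∑ k ∈ Icc 1 N, c k * u k x) atTop S := by
    rw [Metric.uniformCauchySeqOn_iff]
    intro ε hε
    -- Two partial sums differ by two tails, each at most `ε / 4`; `|C| + 1` keeps the divisor
    -- positive whatever the sign of `C`.
    obtain ⟨J, hJ⟩ := main (ε / (4 * (|C| + 1))) (by positivity)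
    have hsplit : ∀ n, 4 ^ J ≤ n → ∀ x, ∑ k ∈ Icc 1 n, c k * u k x =
        ∑ k ∈ Ico 1 (4 ^ J), c k * u k x + ∑ k ∈ Ico (4 ^ J) (n + 1), c k * u k x := by
      intro n hn x
      rw [sum_Ico_consecutive _ (Nat.one_le_pow _ _ (by norm_num)) (by omega)]
      rfl
    have hsmall : ε / (4 * (|C| + 1)) * C ≤ ε / 4 := by
      have : C ≤ |C| + 1 := by linarith [le_abs_self C]
      calc ε / (4 * (|C| + 1)) * C ≤ ε / (4 * (|C| + 1)) * (|C| + 1) := by gcongr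
        _ = ε / 4 := by field_simp
    refine ⟨4 ^ J, fun m hm n hn x hx => ?_⟩
    rw [Real.dist_eq, hsplit m hm, hsplit n hn]
    have h1 := abs_le.1 (hJ (m + 1) (by omega) x hx)
    have h2 := abs_le.1 (hJ (n + 1) (by omega) x hx)
    rw [abs_lt]
    constructor <;> linarith [h1.1, h1.2, h2.1, h2.2]
  choose! g hg using fun x (hx : x ∈ S) =>
    cauchySeq_tendsto_of_complete (hcauchy.cauchySeq hx)
  exact ⟨g, hcauchy.tendstoUniformlyOn_of_tendsto hg⟩

/-- `min a (1 / a)` is at most a constant times the increment of `a / (1 + a)` from `a` to `ρ * a`.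
These increments telescope and their total is at most 1, so neither `t` nor `J` enters the bound. -/
theorem sum_min_geometric_le {ρ t : ℝ} (hρ : 1 < ρ) (ht : 0 ≤ t) (J : ℕ) :
    ∑ j ∈ range J, min (ρ ^ j * t) (1 / (ρ ^ j * t)) ≤ 2 * (ρ + 1) / (ρ - 1) := by
  have hρ1 : 0 < ρ - 1 := by linarith
  have hstep : ∀ a : ℝ, 0 ≤ a →
      min a (1 / a) ≤ 2 * (ρ + 1) / (ρ - 1) * (ρ * a / (1 + ρ * a) - a / (1 + a)) := by
    intro a ha
    have h1 : 0 < 1 + a := by linarith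
    have h2 : 0 < 1 + ρ * a := by positivity
    have heq : 2 * (ρ + 1) / (ρ - 1) * (ρ * a / (1 + ρ * a) - a / (1 + a))
        = 2 * (ρ + 1) * a / ((1 + ρ * a) * (1 + a)) := by
      field_simp
      ring
    rw [heq]
    rcases le_total a 1 with h | h
    · refine (min_le_left _ _).trans ?_
      rw [le_div_iff₀ (by positivity)]
      have : (1 + ρ * a) * (1 + a) ≤ 2 * (ρ + 1) := by
        have h3 : 1 + ρ * a ≤ ρ + 1 := by nlinarith
        nlinarith
      nlinarith
    · refine (min_le_right _ _).trans ?_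
      rw [div_le_div_iff₀ (by linarith) (by positivity)]
      have h3 : 1 + ρ * a ≤ (ρ + 1) * a := by nlinarith
      have h4 : 1 + a ≤ 2 * a := by linarith
      have := mul_le_mul h3 h4 h1.le (by positivity)
      nlinarith
  calc ∑ j ∈ range J, min (ρ ^ j * t) (1 / (ρ ^ j * t))
      ≤ ∑ j ∈ range J, 2 * (ρ + 1) / (ρ - 1) *
          (ρ ^ (j + 1) * t / (1 + ρ ^ (j + 1) * t) - ρ ^ j * t / (1 + ρ ^ j * t)) := by
        refine sum_le_sum fun j _ => ?_
        have := hstep (ρ ^ j * t) (by positivity)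
        rwa [← mul_assoc ρ, ← pow_succ'] at this
    _ = 2 * (ρ + 1) / (ρ - 1) * (ρ ^ J * t / (1 + ρ ^ J * t) - ρ ^ 0 * t / (1 + ρ ^ 0 * t)) := by
        rw [← mul_sum, sum_range_sub (fun j => ρ ^ j * t / (1 + ρ ^ j * t))]
    _ ≤ 2 * (ρ + 1) / (ρ - 1) * 1 := by
        refine mul_le_mul_of_nonneg_left ?_ (by positivity)
        have h1 : ρ ^ J * t / (1 + ρ ^ J * t) ≤ 1 := by
          rw [div_le_one (by positivity)]; linarith
        have h2 : 0 ≤ ρ ^ 0 * t / (1 + ρ ^ 0 * t) := by positivity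
        linarith
    _ = _ := mul_one _

/-! ### The additive character and the Kusmin–Landau inequality -/

/-- `ee x = exp (2 π i x)`. -/
noncomputable def ee (x : ℝ) : ℂ := Complex.exp ((2 * Real.pi * x : ℝ) * Complex.I)

theorem norm_ee (x : ℝ) : ‖ee x‖ = 1 := Complex.norm_exp_ofReal_mul_I _

theorem ee_add (x y : ℝ) : ee (x + y) = ee x * ee y := by
  rw [ee, ee, ee, ← Complex.exp_add]
  push_cast
  ring_nf

theorem ee_re (x : ℝ) : (ee x).re = Real.cos (2 * Real.pi * x) := Complex.exp_ofReal_mul_I_re _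

theorem ee_im (x : ℝ) : (ee x).im = Real.sin (2 * Real.pi * x) := Complex.exp_ofReal_mul_I_im _

theorem conj_ee (x : ℝ) : (starRingEnd ℂ) (ee x) = ee (-x) := by
  apply Complex.ext
  · simp [ee_re]
  · simp [ee_im]

theorem ee_int (n : ℤ) : ee n = 1 := by
  rw [ee, Complex.exp_eq_one_iff]
  exact ⟨n, by push_cast; ring⟩

theorem ee_add_int (x : ℝ) (n : ℤ) : ee (x + n) = ee x := by rw [ee_add, ee_int, mul_one]

theorem norm_sum_ee_neg (φ : ℕ → ℝ) (M : ℕ) :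
    ‖∑ k ∈ range M, ee (-φ k)‖ = ‖∑ k ∈ range M, ee (φ k)‖ := by
  rw [← Complex.norm_conj (∑ k ∈ range M, ee (φ k)), map_sum]
  simp only [conj_ee]

theorem norm_sum_ee_le_card (φ : ℕ → ℝ) (M : ℕ) : ‖∑ k ∈ range M, ee (φ k)‖ ≤ M :=
  (norm_sum_le _ _).trans (by simp [norm_ee])

theorem norm_ee_sub_one_le (x : ℝ) : ‖ee x - 1‖ ≤ 2 * Real.pi * |x| := by
  have h := Real.norm_exp_I_mul_ofReal_sub_one_le (x := 2 * Real.pi * x)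
  rw [mul_comm Complex.I] at h
  refine h.trans_eq ?_
  rw [Real.norm_eq_abs, abs_mul, abs_of_pos Real.two_pi_pos]

/-- A discrete form of the Kusmin–Landau inequality. -/
theorem norm_sum_ee_le_of_monotone_diff {φ : ℕ → ℝ} {M : ℕ} {lam : ℝ} (hlam : 0 < lam)
    (h1 : ∀ k < M, lam ≤ φ (k + 1) - φ k) (h2 : ∀ k < M, φ (k + 1) - φ k ≤ 1 / 2)
    (hm : (∀ k, k + 1 < M → φ (k + 1) - φ k ≤ φ (k + 2) - φ (k + 1)) ∨
      (∀ k, k + 1 < M → φ (k + 2) - φ (k + 1) ≤ φ (k + 1) - φ k)) :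
    ‖∑ k ∈ range M, ee (φ k)‖ ≤ 2 / lam := by
  rcases Nat.eq_zero_or_pos M with rfl | hM
  · simp; positivity
  have hpi := Real.pi_pos
  set D : ℕ → ℝ := fun k => φ (k + 1) - φ k with hD
  set b : ℕ → ℝ := fun k => Real.cos (Real.pi * D k) / Real.sin (Real.pi * D k) with hb
  -- This is `1 / (ee (D k) - 1)`, written with `b k = cot (π * D k)`. Each `ee (φ k)` thus becomes
  -- `w k` times a difference of consecutive values. Monotone `D` makes `b` monotone, so the
  -- variation of `w` telescopes.
  set w : ℕ → ℂ := fun k => -(1 / 2) - ((b k / 2 : ℝ) : ℂ) * Complex.I with hw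
  have hsin : ∀ k < M, 2 * lam ≤ Real.sin (Real.pi * D k) := by
    intro k hk
    have h3 : lam ≤ D k := h1 k hk
    have h4 : D k ≤ 1 / 2 := h2 k hk
    have := Real.mul_le_sin (x := Real.pi * D k)
      (mul_nonneg hpi.le (hlam.le.trans h3)) (by nlinarith)
    have h5 : 2 / Real.pi * (Real.pi * D k) = 2 * D k := by field_simp
    linarith
  have hwmul : ∀ k < M, w k * (ee (D k) - 1) = 1 := by
    intro k hk
    have hs : Real.sin (Real.pi * D k) ≠ 0 := by
      have := hsin k hk
      intro h; linarith
    have hre : Real.cos (2 * Real.pi * D k) = 1 - 2 * Real.sin (Real.pi * D k) ^ 2 := by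
      rw [mul_assoc, Real.cos_two_mul]
      linarith [Real.sin_sq_add_cos_sq (Real.pi * D k)]
    have him : Real.sin (2 * Real.pi * D k)
        = 2 * Real.sin (Real.pi * D k) * Real.cos (Real.pi * D k) := by
      rw [mul_assoc, Real.sin_two_mul]
    have hsc := Real.sin_sq_add_cos_sq (Real.pi * D k)
    have hbk : b k * Real.sin (Real.pi * D k) = Real.cos (Real.pi * D k) := div_mul_cancel₀ _ hs
    have hwre : (w k).re = -(1 / 2) := by
      simp only [hw, Complex.sub_re, Complex.re_ofReal_mul, Complex.I_re]
      norm_num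
    have hwim : (w k).im = -(b k / 2) := by
      simp only [hw, Complex.sub_im, Complex.im_ofReal_mul, Complex.I_im]
      norm_num
    apply Complex.ext
    · rw [Complex.mul_re, hwre, hwim, Complex.sub_re, Complex.sub_im, ee_re, ee_im, hre, him,
        Complex.one_re, Complex.one_im]
      linear_combination Real.cos (Real.pi * D k) * hbk + hsc
    · rw [Complex.mul_im, hwre, hwim, Complex.sub_re, Complex.sub_im, ee_re, ee_im, hre, him,
        Complex.one_im, Complex.one_re]
      linear_combination Real.sin (Real.pi * D k) * hbk
  have hbb : ∀ k < M, 0 ≤ b k ∧ b k ≤ 1 / (2 * lam) := by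
    intro k hk
    have h3 : lam ≤ D k := h1 k hk
    have h4 : D k ≤ 1 / 2 := h2 k hk
    have hs := hsin k hk
    have hc : 0 ≤ Real.cos (Real.pi * D k) :=
      Real.cos_nonneg_of_neg_pi_div_two_le_of_le (by nlinarith) (by nlinarith)
    refine ⟨div_nonneg hc (by linarith), ?_⟩
    exact div_le_div₀ zero_le_one (Real.cos_le_one _) (by linarith) hs
  have hcot : ∀ k < M, ∀ l < M, D k ≤ D l → b l ≤ b k := by
    intro k hk l hl hkl
    have hs := hsin k hk
    have hs' := hsin l hl
    have h3 : lam ≤ D k := h1 k hk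
    have h4 : D l ≤ 1 / 2 := h2 l hl
    rw [hb]
    simp only
    rw [div_le_div_iff₀ (by linarith) (by linarith)]
    have := Real.sin_nonneg_of_nonneg_of_le_pi (x := Real.pi * D l - Real.pi * D k)
      (by nlinarith) (by nlinarith)
    rw [Real.sin_sub] at this
    linarith
  have hvar : ∑ k ∈ range (M - 1), |b (k + 1) - b k| ≤ 1 / (2 * lam) := by
    have h0 := hbb 0 hM
    have h3 := hbb (M - 1) (by omega)
    rcases hm with hm | hm
    · rw [sum_abs_sub_of_ge fun k hk => hcot k (by omega) (k + 1) (by omega) (hm k (by omega))]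
      linarith
    · rw [sum_abs_sub_of_le fun k hk => hcot (k + 1) (by omega) k (by omega) (hm k (by omega))]
      linarith
  have hsum : ∑ k ∈ range M, ee (φ k) = ∑ k ∈ range M, w k * (ee (φ (k + 1)) - ee (φ k)) := by
    refine sum_congr rfl fun k hk => ?_
    have h3 : φ (k + 1) = φ k + D k := by simp [hD]
    rw [h3, ee_add]
    linear_combination -(ee (φ k)) * hwmul k (mem_range.1 hk)
  rw [hsum]
  refine (norm_sum_mul_le w _ (B := 2) M fun m _ => ?_).trans ?_
  · rw [sum_range_sub (fun k => ee (φ k))]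
    refine (norm_sub_le _ _).trans ?_
    rw [norm_ee, norm_ee]
    norm_num
  · have h3 : ‖w (M - 1)‖ ≤ 1 / (2 * lam) := by
      have hb3 := hbb (M - 1) (by omega)
      have hl2 : lam ≤ 1 / 2 := (h1 0 hM).trans (h2 0 hM)
      have h5 : (1 : ℝ) / 2 ≤ 1 / (4 * lam) := by
        rw [div_le_div_iff₀ (by norm_num) (by positivity)]; linarith
      have h6 : ‖w (M - 1)‖ ≤ 1 / 2 + b (M - 1) / 2 := by
        refine (norm_sub_le _ _).trans ?_
        rw [norm_mul, Complex.norm_I, Complex.norm_real, Real.norm_eq_abs,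
          abs_of_nonneg (by linarith)]
        norm_num
      have h7 : 1 / (2 * lam) = 1 / (4 * lam) + 1 / (4 * lam) := by field_simp; norm_num
      linarith
    have h4 : ∑ k ∈ range (M - 1), ‖w (k + 1) - w k‖ ≤ 1 / (2 * lam) := by
      refine le_trans (sum_le_sum fun k _ => ?_) hvar
      have : w (k + 1) - w k = ((-(b (k + 1) - b k) / 2 : ℝ) : ℂ) * Complex.I := by
        simp only [hw]; push_cast; ring
      rw [this, norm_mul, Complex.norm_I, Complex.norm_real, Real.norm_eq_abs, abs_div, abs_neg]
      have := abs_nonneg (b (k + 1) - b k)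
      norm_num
    have h5 : 2 / lam = 2 * (1 / (2 * lam) + 1 / (2 * lam)) := by field_simp; norm_num
    rw [h5]
    linarith

/-! ### The divisor bound -/

/-- Compare `v + 1` with `p ^ (v * ε)` prime by prime. If `p ≥ 2 ^ (1 / ε)`, then `v + 1 ≤ 2 ^ v`
suffices. Each of the fewer than `P` smaller primes loses at most a factor `K`, chosen so that `1 +
v ≤ K * (1 + v * ε * log 2)`. -/
theorem exists_card_divisors_le {ε : ℝ} (hε : 0 < ε) :
    ∃ C : ℝ, 1 ≤ C ∧ ∀ n : ℕ, 0 < n → (n.divisors.card : ℝ) ≤ C * (n : ℝ) ^ ε := by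
  have hlog := Real.log_pos one_lt_two
  set K : ℝ := max 1 (1 / (ε * Real.log 2)) with hK
  have hK1 : 1 ≤ K := le_max_left _ _
  obtain ⟨P, hP⟩ := exists_nat_ge ((2 : ℝ) ^ (1 / ε))
  refine ⟨K ^ P, one_le_pow₀ hK1, fun n hn => ?_⟩
  have hlocal : ∀ p : ℕ, p.Prime → ∀ v : ℕ,
      ((v + 1 : ℕ) : ℝ) ≤ (if p < P then K else 1) * ((p : ℝ) ^ v) ^ ε := by
    intro p hp v
    have hp2 : (2 : ℝ) ≤ p := by exact_mod_cast hp.two_le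
    split_ifs with h
    · have h1 : ((2 : ℝ) ^ v) ^ ε ≤ ((p : ℝ) ^ v) ^ ε := by gcongr
      have h2 : 1 + v * (ε * Real.log 2) ≤ ((2 : ℝ) ^ v) ^ ε := by
        rw [← Real.rpow_natCast, ← Real.rpow_mul (by norm_num), Real.rpow_def_of_pos (by norm_num)]
        have := Real.add_one_le_exp (Real.log 2 * (v * ε))
        linarith
      have h3 : 1 ≤ K * (ε * Real.log 2) := by
        have : 1 / (ε * Real.log 2) ≤ K := le_max_right _ _
        rwa [div_le_iff₀ (by positivity)] at this
      have h4 : (v : ℝ) ≤ K * (v * (ε * Real.log 2)) := by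
        have := mul_le_mul_of_nonneg_left h3 (Nat.cast_nonneg (α := ℝ) v)
        linarith
      push_cast
      calc (v : ℝ) + 1 ≤ K * (1 + v * (ε * Real.log 2)) := by linarith
        _ ≤ _ := by gcongr; exact h2.trans h1
    · have h1 : (2 : ℝ) ≤ (p : ℝ) ^ ε := by
        have h2 : (2 : ℝ) ^ (1 / ε) ≤ p := hP.trans (by exact_mod_cast not_lt.1 h)
        calc (2 : ℝ) = ((2 : ℝ) ^ (1 / ε)) ^ ε := by
              rw [← Real.rpow_mul (by norm_num), one_div, inv_mul_cancel₀ hε.ne', Real.rpow_one]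
          _ ≤ _ := by gcongr
      rw [one_mul, ← Real.rpow_natCast, ← Real.rpow_mul (by positivity), mul_comm (v : ℝ),
        Real.rpow_mul (by positivity), Real.rpow_natCast]
      calc ((v + 1 : ℕ) : ℝ) ≤ (2 : ℝ) ^ v := by
            exact_mod_cast Nat.lt_two_pow_self
        _ ≤ _ := by gcongr
  have hprod : (n : ℝ) ^ ε = ∏ p ∈ n.primeFactors, ((p : ℝ) ^ n.factorization p) ^ ε := by
    rw [Real.finsetProd_rpow _ _ fun p _ => by positivity]
    congr 1
    conv_lhs => rw [← Nat.prod_factorization_pow_eq_self hn.ne']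
    rw [Finsupp.prod, Nat.support_factorization]
    push_cast
    rfl
  rw [Nat.card_divisors hn.ne', Nat.cast_prod, hprod]
  calc ∏ p ∈ n.primeFactors, ((n.factorization p + 1 : ℕ) : ℝ)
      ≤ ∏ p ∈ n.primeFactors, (if p < P then K else 1) * ((p : ℝ) ^ n.factorization p) ^ ε :=
        prod_le_prod (fun _ _ => by positivity) fun p hp =>
          hlocal p (Nat.prime_of_mem_primeFactors hp) _
    _ = (∏ p ∈ n.primeFactors, if p < P then K else 1) *
          ∏ p ∈ n.primeFactors, ((p : ℝ) ^ n.factorization p) ^ ε := prod_mul_distrib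
    _ ≤ _ := by
        refine mul_le_mul_of_nonneg_right ?_ (prod_nonneg fun _ _ => by positivity)
        rw [← prod_filter, prod_const]
        refine pow_le_pow_right₀ hK1 ?_
        calc (n.primeFactors.filter (· < P)).card ≤ (range P).card :=
              card_le_card fun p hp => mem_range.2 (mem_filter.1 hp).2
          _ = P := card_range P

/-! ### Weyl differencing -/

/-- The square of the sum plus its diagonal is twice the real part of the sum over pairs `n ≤ m`;
drop the diagonal and group the pairs by the shift `h = m - n`. Letting `h` run to `N` only adds
empty inner sums and makes the bound uniform in `M`. -/
theorem norm_sq_sum_le_correlations (z : ℕ → ℂ) {M N : ℕ} (hMN : M ≤ N) :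
    ‖∑ n ∈ range M, z n‖ ^ 2 ≤
      2 * ∑ h ∈ range N, ‖∑ n ∈ range (M - h), z (n + h) * (starRingEnd ℂ) (z n)‖ := by
  have hA : ∑ h ∈ range M, ∑ n ∈ range (M - h), z (n + h) * (starRingEnd ℂ) (z n)
      = ∑ m ∈ range M, z m * (starRingEnd ℂ) (∑ n ∈ range (m + 1), z n) := by
    rw [← sum_range_diag_flip M (fun h n => z (n + h) * (starRingEnd ℂ) (z n))]
    refine sum_congr rfl fun m _ => ?_
    rw [← sum_range_reflect, map_sum, mul_sum]
    refine sum_congr rfl fun k hk => ?_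
    rw [mem_range] at hk
    rw [show m - (m + 1 - 1 - k) + (m + 1 - 1 - k) = m by omega,
      show m - (m + 1 - 1 - k) = k by omega]
  have hid : ∀ M, ‖∑ n ∈ range M, z n‖ ^ 2 + ∑ n ∈ range M, ‖z n‖ ^ 2
      = 2 * (∑ m ∈ range M, z m * (starRingEnd ℂ) (∑ n ∈ range (m + 1), z n)).re := by
    intro M
    induction M with
    | zero => simp
    | succ M ih =>
      rw [sum_range_succ (fun n => ‖z n‖ ^ 2),
        sum_range_succ (fun m => z m * (starRingEnd ℂ) (∑ n ∈ range (m + 1), z n)),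
        Complex.add_re, mul_add, ← ih, sum_range_succ z]
      simp only [Complex.sq_norm, Complex.normSq_apply, Complex.mul_re, Complex.conj_re,
        Complex.conj_im, Complex.add_re, Complex.add_im]
      ring
  have h1 := hid M
  rw [← hA] at h1
  have h2 : 0 ≤ ∑ n ∈ range M, ‖z n‖ ^ 2 := by positivity
  have h3 : (∑ h ∈ range M, ∑ n ∈ range (M - h), z (n + h) * (starRingEnd ℂ) (z n)).re ≤
      ∑ h ∈ range N, ‖∑ n ∈ range (M - h), z (n + h) * (starRingEnd ℂ) (z n)‖ :=
    ((Complex.re_le_norm _).trans (norm_sum_le _ _)).trans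
      (sum_le_sum_of_subset_of_nonneg (range_mono hMN) fun _ _ _ => norm_nonneg _)
  linarith

theorem norm_sq_sum_ee_le (φ : ℕ → ℝ) {M N : ℕ} (hMN : M ≤ N) :
    ‖∑ n ∈ range M, ee (φ n)‖ ^ 2 ≤
      2 * ∑ h ∈ range N, ‖∑ n ∈ range (M - h), ee (φ (n + h) - φ n)‖ := by
  refine (norm_sq_sum_le_correlations (fun n => ee (φ n)) hMN).trans_eq ?_
  simp only [conj_ee, ← ee_add, sub_eq_add_neg]

/-! ### Linear phases and iterated differencing. -/

/-- The distance to the nearest integer. -/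
noncomputable def distInt (x : ℝ) : ℝ := |x - round x|

theorem distInt_le (x : ℝ) (n : ℤ) : distInt x ≤ |x - n| := round_le x n

theorem distInt_neg (x : ℝ) : distInt (-x) = distInt x := by
  have h : ∀ y, distInt (-y) ≤ distInt y := by
    intro y
    refine (distInt_le (-y) (-round y)).trans_eq ?_
    rw [distInt, ← abs_neg]
    push_cast
    ring_nf
  exact le_antisymm (h x) (by simpa using h (-x))

open scoped Classical in
/-- A bound for linear exponential sums of length at most `N`, with threshold `t`. -/
noncomputable def linearBound (N : ℕ) (t θ : ℝ) : ℝ := 2 / t + if distInt θ ≤ t then (N : ℝ) else 0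

theorem linearBound_nonneg {N : ℕ} {t : ℝ} (ht : 0 < t) (θ : ℝ) : 0 ≤ linearBound N t θ := by
  unfold linearBound
  split_ifs <;> positivity

theorem linearBound_le {N : ℕ} {t : ℝ} (θ : ℝ) : linearBound N t θ ≤ 2 / t + N := by
  unfold linearBound
  split_ifs <;> simp

theorem norm_sum_ee_linear_le {M : ℕ} (θ c : ℝ) (h : 0 < distInt θ) :
    ‖∑ n ∈ range M, ee (θ * n + c)‖ ≤ 2 / distInt θ := by
  have hred : ∀ n : ℕ, ee (θ * n + c) = ee ((θ - round θ) * n + c) := by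
    intro n
    rw [← ee_add_int ((θ - round θ) * n + c) (round θ * n)]
    push_cast
    ring_nf
  simp only [hred]
  have h2 : distInt θ ≤ 1 / 2 := abs_sub_round θ
  rcases le_total 0 (θ - round θ) with h0 | h0
  · have he : distInt θ = θ - round θ := abs_of_nonneg h0
    refine norm_sum_ee_le_of_monotone_diff h (fun k _ => ?_) (fun k _ => ?_)
      (Or.inl fun k _ => ?_) <;> push_cast <;> linarith
  · have he : distInt θ = -(θ - round θ) := abs_of_nonpos h0
    rw [← norm_sum_ee_neg]
    refine norm_sum_ee_le_of_monotone_diff h (fun k _ => ?_) (fun k _ => ?_)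
      (Or.inl fun k _ => ?_) <;> push_cast <;> linarith

theorem norm_sum_ee_linear_le_linearBound {M N : ℕ} (hMN : M ≤ N) {t : ℝ} (ht : 0 < t)
    (θ c : ℝ) : ‖∑ n ∈ range M, ee (θ * n + c)‖ ≤ linearBound N t θ := by
  unfold linearBound
  split_ifs with h
  · have h1 := norm_sum_ee_le_card (fun n => θ * n + c) M
    have h2 : (M : ℝ) ≤ N := by exact_mod_cast hMN
    have : 0 < 2 / t := by positivity
    linarith
  · rw [add_zero]
    push Not at h
    exact (norm_sum_ee_linear_le θ c (ht.trans h)).trans (by gcongr)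

theorem natDegree_taylor_sub_le {P : Polynomial ℝ} {k : ℕ} (hP : P.natDegree ≤ k + 2) (h : ℝ) :
    (Polynomial.taylor h P - P).natDegree ≤ k + 1 := by
  rw [Polynomial.natDegree_le_iff_coeff_eq_zero]
  intro j hj
  rw [Polynomial.coeff_sub, Polynomial.taylor_coeff]
  have hd : (Polynomial.hasseDeriv j P).natDegree < 1 :=
    (Polynomial.natDegree_hasseDeriv_le P j).trans_lt (by omega)
  rw [Polynomial.eval_eq_sum_range' hd]
  simp [Polynomial.hasseDeriv_coeff]

/-- Differencing multiplies the top coefficient by degree times shift; iterated, this produces the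
factorial and the product of shifts in `weyl_differencing`. -/
theorem coeff_taylor_sub {P : Polynomial ℝ} {k : ℕ} (hP : P.natDegree ≤ k + 2) (h : ℝ) :
    (Polynomial.taylor h P - P).coeff (k + 1) = (k + 2) * h * P.coeff (k + 2) := by
  rw [Polynomial.coeff_sub, Polynomial.taylor_coeff]
  have hd : (Polynomial.hasseDeriv (k + 1) P).natDegree < 2 :=
    (Polynomial.natDegree_hasseDeriv_le P _).trans_lt (by omega)
  rw [Polynomial.eval_eq_sum_range' hd]
  have h1 : 1 + (k + 1) = k + 2 := by omega
  simp [sum_range_succ, Polynomial.hasseDeriv_coeff, h1]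
  ring

/-- The sum of `φ (h₁ ⋯ h_k)` over all `h₁, …, h_k < N`. -/
noncomputable def sumProd (N : ℕ) : ℕ → (ℕ → ℝ) → ℝ
  | 0, φ => φ 1
  | k + 1, φ => ∑ h ∈ range N, sumProd N k fun m => φ (h * m)

/-- Each squaring replaces `P` by `P(X + h) - P`, of one degree less, until the phase is linear. The
power mean inequality moves the exponent `2 ^ k` inside the sum over `h`, at the cost of powers of
`N`. -/
theorem weyl_differencing {N : ℕ} (hN : 0 < N) {t : ℝ} (ht : 0 < t) (k : ℕ) :
    ∀ (P : Polynomial ℝ), P.natDegree ≤ k + 1 → ∀ M ≤ N,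
      (N : ℝ) ^ k * ‖∑ n ∈ range M, ee (P.eval (n : ℝ))‖ ^ 2 ^ k ≤ (2 * N : ℝ) ^ (2 ^ k - 1) *
        sumProd N k fun m => linearBound N t ((k + 1).factorial * P.coeff (k + 1) * m) := by
  induction k with
  | zero =>
    intro P hP M hM
    have := norm_sum_ee_linear_le_linearBound hM ht (P.coeff 1) (P.coeff 0)
    simp only [sumProd]
    have he : ∀ n : ℕ, P.eval (n : ℝ) = P.coeff 1 * n + P.coeff 0 := by
      intro n
      rw [Polynomial.eval_eq_sum_range' (n := 2) (by omega)]
      simp [sum_range_succ, add_comm]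
    simp only [he]
    simpa using this
  | succ k ih =>
    intro P hP M hM
    have hpos : 0 < 2 ^ k := by positivity
    obtain ⟨e, he⟩ : ∃ e, 2 ^ k = e + 1 := ⟨2 ^ k - 1, by omega⟩
    have hNR : (0 : ℝ) < N := by exact_mod_cast hN
    set s : ℕ → ℝ := fun h =>
      ‖∑ n ∈ range (M - h), ee ((Polynomial.taylor (h : ℝ) P - P).eval (n : ℝ))‖ with hs
    have h1 : ‖∑ n ∈ range M, ee (P.eval (n : ℝ))‖ ^ 2 ≤ 2 * ∑ h ∈ range N, s h := by
      refine (norm_sq_sum_ee_le (fun n => P.eval (n : ℝ)) hM).trans_eq ?_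
      simp [hs, Polynomial.taylor_eval]
    have h2 : (∑ h ∈ range N, s h) ^ 2 ^ k ≤ (N : ℝ) ^ e * ∑ h ∈ range N, s h ^ 2 ^ k := by
      rw [he]
      have := pow_sum_div_card_le_sum_pow (s := range N) (f := s) (n := e)
        (fun i _ => norm_nonneg _)
      rw [card_range, div_le_iff₀ (by positivity)] at this
      linarith
    have h3 : ∀ h : ℕ, (N : ℝ) ^ k * s h ^ 2 ^ k ≤ (2 * N : ℝ) ^ e *
        sumProd N k fun m =>
          linearBound N t ((k + 1 + 1).factorial * P.coeff (k + 1 + 1) * ((h * m : ℕ) : ℝ)) := by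
      intro h
      have := ih (Polynomial.taylor (h : ℝ) P - P) (natDegree_taylor_sub_le hP _) (M - h)
        (by omega)
      rw [he, Nat.add_sub_cancel] at this
      rw [he]
      refine this.trans_eq ?_
      congr 2
      funext m
      rw [coeff_taylor_sub hP, Nat.factorial_succ (k + 1)]
      push_cast
      ring_nf
    have he2 : 2 ^ (k + 1) - 1 = e + 1 + e := by rw [pow_succ]; omega
    calc (N : ℝ) ^ (k + 1) * ‖∑ n ∈ range M, ee (P.eval (n : ℝ))‖ ^ 2 ^ (k + 1)
        = (N : ℝ) ^ (k + 1) * (‖∑ n ∈ range M, ee (P.eval (n : ℝ))‖ ^ 2) ^ 2 ^ k := by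
          rw [pow_succ 2 k, mul_comm (2 ^ k) 2, pow_mul]
      _ ≤ (N : ℝ) ^ (k + 1) * (2 * ∑ h ∈ range N, s h) ^ 2 ^ k := by gcongr
      _ = (N : ℝ) ^ (k + 1) * 2 ^ (e + 1) * (∑ h ∈ range N, s h) ^ 2 ^ k := by
          rw [mul_pow, he]; ring
      _ ≤ (N : ℝ) ^ (k + 1) * 2 ^ (e + 1) * ((N : ℝ) ^ e * ∑ h ∈ range N, s h ^ 2 ^ k) := by
          gcongr
      _ = (2 * N : ℝ) ^ (e + 1) * ∑ h ∈ range N, (N : ℝ) ^ k * s h ^ 2 ^ k := by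
          rw [← mul_sum]; ring
      _ ≤ (2 * N : ℝ) ^ (e + 1) * ∑ h ∈ range N, ((2 * N : ℝ) ^ e * sumProd N k fun m =>
          linearBound N t ((k + 1 + 1).factorial * P.coeff (k + 1 + 1) * ((h * m : ℕ) : ℝ))) := by
          exact mul_le_mul_of_nonneg_left (sum_le_sum fun h _ => h3 h) (by positivity)
      _ = _ := by
          rw [← mul_sum, he2, pow_add _ (e + 1) e, mul_assoc, sumProd]

theorem sumProd_const (N k : ℕ) (a : ℝ) : sumProd N k (fun _ => a) = (N : ℝ) ^ k * a := by
  induction k with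
  | zero => simp [sumProd]
  | succ k ih => simp [sumProd, ih]; ring

/-- A pair with product `n` is determined by its first factor, a divisor of `n`. -/
theorem sum_sum_mul_le_divisors {φ : ℕ → ℝ} (hφ : ∀ m, 0 ≤ φ m) {N K : ℕ} {D : ℝ}
    (hD : ∀ n, 0 < n → n ≤ N * K → (n.divisors.card : ℝ) ≤ D) :
    ∑ h ∈ Ico 1 N, ∑ m ∈ Icc 1 K, φ (h * m) ≤ D * ∑ n ∈ Icc 1 (N * K), φ n := by
  rw [← sum_product', mul_sum]
  have hmaps : ∀ x ∈ Ico 1 N ×ˢ Icc 1 K, x.1 * x.2 ∈ Icc 1 (N * K) := by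
    rintro ⟨h, m⟩ hx
    simp only [mem_product, mem_Ico, mem_Icc] at hx ⊢
    exact ⟨Nat.mul_pos hx.1.1 hx.2.1, Nat.mul_le_mul hx.1.2.le hx.2.2⟩
  rw [← sum_fiberwise_of_maps_to hmaps]
  refine sum_le_sum fun n hn => ?_
  rw [mem_Icc] at hn
  have : ∑ x ∈ Ico 1 N ×ˢ Icc 1 K with x.1 * x.2 = n, φ (x.1 * x.2)
      = (((Ico 1 N ×ˢ Icc 1 K).filter fun x => x.1 * x.2 = n).card : ℝ) * φ n := by
    rw [← nsmul_eq_mul, ← sum_const]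
    exact sum_congr rfl fun x hx => by rw [(mem_filter.1 hx).2]
  rw [this]
  refine mul_le_mul_of_nonneg_right (le_trans ?_ (hD n hn.1 hn.2)) (hφ n)
  refine Nat.cast_le.2 (card_le_card_of_injOn Prod.fst ?_ ?_)
  · intro x hx
    have hx2 := (mem_filter.1 (mem_coe.1 hx)).2
    exact mem_coe.2 (Nat.mem_divisors.2 ⟨⟨x.2, hx2.symm⟩, by omega⟩)
  · intro x hx x' hx' heq
    have hx2 := mem_filter.1 (mem_coe.1 hx)
    have hx2' := mem_filter.1 (mem_coe.1 hx')
    have h0 : 0 < x.1 := (mem_Ico.1 (mem_product.1 hx2.1).1).1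
    refine Prod.ext heq (Nat.eq_of_mul_eq_mul_left h0 ?_)
    rw [hx2.2, heq, hx2'.2]

/-- The first term pays for the at most `k * N ^ (k - 1)` tuples with a zero entry. In the second,
each of the `k` stages costs one divisor count. -/
theorem sumProd_le {N : ℕ} (hN : 0 < N) (k : ℕ) {D : ℝ} (hD0 : 0 ≤ D)
    (hD : ∀ n, 0 < n → n ≤ N ^ k → (n.divisors.card : ℝ) ≤ D) :
    ∀ {φ : ℕ → ℝ}, (∀ m, 0 ≤ φ m) →
      sumProd N k φ ≤ k * ((N : ℝ) ^ k / N) * φ 0 + D ^ k * ∑ m ∈ Icc 1 (N ^ k), φ m := by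
  have hNR : (0 : ℝ) < N := by exact_mod_cast hN
  induction k with
  | zero => intro φ _; simp [sumProd]
  | succ k ih =>
    intro φ hφ
    have hstep := fun h : ℕ => ih (fun n hn hnk => hD n hn
      (hnk.trans (Nat.pow_le_pow_right hN k.le_succ))) (φ := fun m => φ (h * m)) fun m => hφ _
    rw [sumProd, range_eq_Ico, sum_eq_sum_Ico_succ_bot hN]
    simp only [zero_mul, sumProd_const, zero_add]
    have h1 : ∑ h ∈ Ico 1 N, sumProd N k (fun m => φ (h * m)) ≤
        N * (k * ((N : ℝ) ^ k / N) * φ 0) +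
          D ^ k * ∑ h ∈ Ico 1 N, ∑ m ∈ Icc 1 (N ^ k), φ (h * m) := by
      refine (sum_le_sum fun h _ => hstep h).trans ?_
      rw [sum_add_distrib]
      refine add_le_add ?_ (mul_sum _ _ _).symm.le
      simp only [mul_zero, sum_const, Nat.card_Ico, nsmul_eq_mul]
      exact mul_le_mul_of_nonneg_right (by exact_mod_cast Nat.sub_le N 1)
        (mul_nonneg (by positivity) (hφ 0))
    have h2 := sum_sum_mul_le_divisors hφ (N := N) (K := N ^ k) (D := D) (by
      rwa [← pow_succ'])
    rw [← pow_succ'] at h2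
    have h3 := mul_le_mul_of_nonneg_left h2 (pow_nonneg hD0 k)
    have h4 : N * (k * ((N : ℝ) ^ k / N) * φ 0) = k * (N : ℝ) ^ k * φ 0 := by
      field_simp
    have h5 : ((k + 1 : ℕ) : ℝ) * ((N : ℝ) ^ (k + 1) / N) * φ 0
        = (N : ℝ) ^ k * φ 0 + k * (N : ℝ) ^ k * φ 0 := by
      rw [pow_succ, mul_div_assoc, div_self hNR.ne']; push_cast; ring
    rw [h5, pow_succ D k]
    linarith

/-! ### Diophantine counting and Weyl's inequality. -/

/-- The number of `m ≤ K` for which `y m` is within `t` of an integer, when `y` is close to a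
reduced fraction with denominator `q`. -/
theorem card_distInt_le {y : ℝ} {a : ℤ} {q : ℕ} (hq : 0 < q) (haq : IsCoprime a (q : ℤ))
    (hy : |y - a / q| ≤ 1 / (q : ℝ) ^ 2) {t : ℝ} (ht : 0 ≤ t) (K : ℕ) {s : Finset ℕ}
    (hs : ∀ m ∈ s, m ≤ K ∧ distInt (y * m) ≤ t) :
    (s.card : ℝ) ≤ (2 * K / q + 1) * (4 * q * t + 2) := by
  have hqR : (0 : ℝ) < q := by exact_mod_cast hq
  -- Distinct indices in one block of length `L` differ by some `e ≤ q / 2`. Then `e * a / q` is at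
  -- least `1 / q` from every integer, while replacing `a / q` by `y` costs at most `1 / (2 * q)`.
  -- So the `2 * q * z m` in a block are at least 1 apart and have distinct floors.
  set L : ℕ := (q + 1) / 2 with hL
  have hL0 : 0 < L := by omega
  set z : ℕ → ℝ := fun m => y * m - round (y * m) with hz
  set F : ℕ → ℕ × ℤ := fun m => (m / L, ⌊2 * q * z m⌋) with hF
  have hsep : ∀ m m' : ℕ, m < m' → m / L = m' / L → ⌊2 * q * z m⌋ ≠ ⌊2 * q * z m'⌋ := by
    intro m m' hlt hdiv hfl
    have h1 := Int.abs_sub_lt_one_of_floor_eq_floor hfl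
    obtain ⟨e, rfl⟩ : ∃ e, m' = m + e := ⟨m' - m, by omega⟩
    have he0 : 0 < e := by omega
    have he : 2 * e ≤ q := by
      have h2 := Nat.div_add_mod m L
      have h3 := Nat.div_add_mod (m + e) L
      have h4 := Nat.mod_lt (m + e) hL0
      rw [← hdiv] at h3
      omega
    set n : ℤ := round (y * ((m + e : ℕ) : ℝ)) - round (y * m) with hn
    have hne : (1 : ℝ) ≤ |(a * e - n * q : ℤ)| := by
      have : a * e - n * q ≠ 0 := by
        intro h0
        have hdvd : (q : ℤ) ∣ a * e := ⟨n, by linarith⟩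
        have := haq.symm.dvd_of_dvd_mul_left hdvd
        have := Nat.le_of_dvd he0 (Int.natCast_dvd_natCast.1 this)
        omega
      exact_mod_cast Int.one_le_abs this
    have hzz : z (m + e) - z m = y * e - n := by
      simp only [hz, hn]; push_cast; ring
    have h5 : (a * e - n * q : ℤ) = q * (z (m + e) - z m) - q * e * (y - a / q) := by
      rw [hzz]; push_cast; field_simp; ring
    have h6 : |q * e * (y - a / q)| ≤ 1 / 2 := by
      rw [abs_mul, abs_of_nonneg (by positivity)]
      have h7 : (2 * e : ℝ) ≤ q := by exact_mod_cast he
      calc (q : ℝ) * e * |y - a / q| ≤ q * e * (1 / (q : ℝ) ^ 2) := by gcongr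
        _ = e / q := by field_simp
        _ ≤ 1 / 2 := by rw [div_le_div_iff₀ hqR (by norm_num)]; linarith
    have h8 : |2 * q * z m - 2 * q * z (m + e)| = 2 * |q * (z (m + e) - z m)| := by
      rw [abs_sub_comm, ← mul_sub, mul_assoc, abs_mul, abs_of_pos (by norm_num : (0 : ℝ) < 2)]
    rw [h8] at h1
    rw [Int.cast_abs, h5] at hne
    have := abs_sub (q * (z (m + e) - z m)) (q * e * (y - a / q))
    linarith
  have hinj : Set.InjOn F s := by
    intro m _ m' _ h
    simp only [hF, Prod.mk.injEq] at h
    by_contra hne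
    rcases lt_or_gt_of_ne hne with hlt | hlt
    · exact hsep m m' hlt h.1 h.2
    · exact hsep m' m hlt h.1.symm h.2.symm
  have hmaps : Set.MapsTo F s (range (K / L + 1) ×ˢ Icc ⌊-(2 * q * t)⌋ ⌊2 * q * t⌋ : Finset _) := by
    intro m hm
    obtain ⟨hmK, hmt⟩ := hs m hm
    have hzm := abs_le.1 (show |z m| ≤ t from hmt)
    simp only [hF, coe_product, Set.mem_prod, mem_coe, mem_range, mem_Icc]
    refine ⟨Nat.lt_succ_of_le (Nat.div_le_div_right hmK), Int.floor_le_floor ?_,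
      Int.floor_le_floor ?_⟩
    · nlinarith [hzm.1]
    · nlinarith [hzm.2]
  have hcard := card_le_card_of_injOn F hmaps hinj
  rw [card_product, card_range, Int.card_Icc] at hcard
  have hqt : 0 ≤ 2 * q * t := by positivity
  have h1 : ((K / L + 1 : ℕ) : ℝ) ≤ 2 * K / q + 1 := by
    push_cast
    gcongr
    refine Nat.cast_div_le.trans ?_
    rw [div_le_div_iff₀ (by exact_mod_cast hL0) hqR]
    have : q ≤ 2 * L := by omega
    have : (q : ℝ) ≤ 2 * L := by exact_mod_cast this
    nlinarith [Nat.cast_nonneg (α := ℝ) K]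
  have h2 : ((⌊2 * q * t⌋ + 1 - ⌊-(2 * q * t)⌋).toNat : ℝ) ≤ 4 * q * t + 2 := by
    have hnn : 0 ≤ ⌊2 * q * t⌋ + 1 - ⌊-(2 * q * t)⌋ := by
      have := Int.floor_le_floor (show -(2 * q * t) ≤ 2 * q * t by linarith)
      omega
    have : ((⌊2 * q * t⌋ + 1 - ⌊-(2 * q * t)⌋).toNat : ℝ)
        = ((⌊2 * q * t⌋ + 1 - ⌊-(2 * q * t)⌋ : ℤ) : ℝ) := by
      exact_mod_cast congrArg (Int.cast (R := ℝ)) (Int.toNat_of_nonneg hnn)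
    rw [this]
    push_cast
    have h3 := Int.floor_le (2 * q * t)
    have h4 := Int.lt_floor_add_one (-(2 * q * t))
    linarith
  calc (s.card : ℝ) ≤ ((K / L + 1 : ℕ) : ℝ) *
        ((⌊2 * q * t⌋ + 1 - ⌊-(2 * q * t)⌋).toNat : ℝ) := by exact_mod_cast hcard
    _ ≤ _ := by gcongr

/-- The multiplier `B` is moved into the index: the injection `m ↦ |B| * m` reduces the count to
multiples of `y` itself, so only `y` needs a rational approximation. -/
theorem sum_linearBound_le {y : ℝ} {a : ℤ} {q : ℕ} (hq : 0 < q) (haq : IsCoprime a (q : ℤ))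
    (hy : |y - a / q| ≤ 1 / (q : ℝ) ^ 2) {t : ℝ} (ht : 0 < t) {B : ℤ} (hB : B ≠ 0) (N K : ℕ) :
    ∑ m ∈ Icc 1 K, linearBound N t (B * y * m) ≤
      2 * K / t + N * ((2 * (|B| * K) / q + 1) * (4 * q * t + 2)) := by
  classical
  unfold linearBound
  rw [sum_add_distrib, ← sum_filter, sum_const, sum_const, nsmul_eq_mul, nsmul_eq_mul,
    Nat.card_Icc, mul_comm _ (N : ℝ)]
  refine add_le_add (le_of_eq ?_) (mul_le_mul_of_nonneg_left ?_ (Nat.cast_nonneg N))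
  · rw [Nat.add_sub_cancel]; ring
  · have hB0 : 0 < B.natAbs := Int.natAbs_pos.2 hB
    have hcard := card_distInt_le hq haq hy ht.le (B.natAbs * K)
      (s := ((Icc 1 K).filter fun m : ℕ => distInt (B * y * m) ≤ t).image (B.natAbs * ·)) (by
        intro m hm
        obtain ⟨n, hn, rfl⟩ := mem_image.1 hm
        rw [mem_filter, mem_Icc] at hn
        refine ⟨Nat.mul_le_mul_left _ hn.1.2, ?_⟩
        rcases Int.natAbs_eq B with h | h
        · have h2 : (B : ℝ) = (B.natAbs : ℝ) := by rw [← Int.cast_natCast, ← h]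
          rw [h2] at hn
          refine le_of_eq_of_le ?_ hn.2
          rw [Nat.cast_mul]; ring_nf
        · have h2 : (B : ℝ) = -(B.natAbs : ℝ) := by
            rw [← Int.cast_natCast, ← Int.cast_neg, ← h]
          rw [h2] at hn
          refine le_of_eq_of_le ?_ hn.2
          rw [← distInt_neg, Nat.cast_mul]; ring_nf)
    rw [card_image_of_injective _ (mul_right_injective₀ hB0.ne')] at hcard
    refine hcard.trans_eq ?_
    rw [Nat.cast_mul, Nat.cast_natAbs]

/-- The Weyl inequality with an unspecified power saving: if the multiplier `y` of an integer
polynomial of degree `k + 1 ≥ 2` is close to a reduced fraction whose denominator `q` lies between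
`N ^ (1 / 2)` and `N ^ (k + 1 / 2)`, the exponential sums of length at most `N` are small. -/
theorem weyl_inequality {k : ℕ} (hk : 0 < k) {A : ℤ} (hA : A ≠ 0) :
    ∃ C δ : ℝ, 0 < C ∧ 0 < δ ∧ ∀ (y : ℝ) (P : Polynomial ℝ) (a : ℤ) (q N M : ℕ),
      P.natDegree ≤ k + 1 → P.coeff (k + 1) = A * y → 0 < q → IsCoprime a (q : ℤ) →
      |y - a / q| ≤ 1 / (q : ℝ) ^ 2 → 0 < N → N ≤ q ^ 2 → q ^ 2 ≤ N ^ (2 * k + 1) → M ≤ N →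
      ‖∑ n ∈ range M, ee (P.eval (n : ℝ))‖ ≤ C * (N : ℝ) ^ (1 - δ) := by
  have hkR : (0 : ℝ) < k := by exact_mod_cast hk
  -- Divisor counts up to `N ^ k`, raised to the power `k`, then cost only `N ^ (k ^ 2 * ε) = N ^ (1
  -- / 8)`.
  set ε : ℝ := 1 / (8 * (k : ℝ) ^ 2) with hε
  have hε0 : 0 < ε := by positivity
  obtain ⟨Cd, hCd1, hCd⟩ := exists_card_divisors_le hε0
  set B : ℤ := (k + 1).factorial * A with hB
  have hB0 : B ≠ 0 := mul_ne_zero (by exact_mod_cast (Nat.factorial_pos _).ne') hA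
  set b : ℝ := ((|B| : ℤ) : ℝ) with hb
  have hb0 : 0 ≤ b := by rw [hb]; exact_mod_cast abs_nonneg B
  set C₁ : ℝ := 3 * k + Cd ^ k * (12 * b + 8) with hC₁
  have hC₁1 : 1 ≤ C₁ := by
    have : 1 ≤ Cd ^ k := one_le_pow₀ hCd1
    nlinarith
  set C : ℝ := 2 ^ (2 ^ k - 1) * C₁ with hC
  have hC1 : 1 ≤ C := by
    have : (1 : ℝ) ≤ 2 ^ (2 ^ k - 1) := one_le_pow₀ (by norm_num)
    nlinarith
  -- A factor `N ^ (1 / 8)` is saved on the `2 ^ k`-th power: `1 / 4` from counting, less `1 / 8`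
  -- for divisors.
  refine ⟨C, 1 / (8 * 2 ^ k), by linarith, by positivity, ?_⟩
  intro y P a q N M hdeg hcoeff hq haq hy hN hNq hqN hMN
  have hNR : (0 : ℝ) < N := by exact_mod_cast hN
  have hN1 : (1 : ℝ) ≤ N := by exact_mod_cast hN
  have hqR : (0 : ℝ) < q := by exact_mod_cast hq
  have hpow : ∀ {r s : ℝ}, r ≤ s → (N : ℝ) ^ r ≤ (N : ℝ) ^ s := fun h =>
    Real.rpow_le_rpow_of_exponent_le hN1 h
  have hsq : (N : ℝ) ^ (1 / 2 : ℝ) ≤ q := by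
    rw [← Real.sqrt_eq_rpow]
    exact Real.sqrt_le_iff.2 ⟨hqR.le, by exact_mod_cast hNq⟩
  have hqle : (q : ℝ) ≤ (N : ℝ) ^ ((k : ℝ) + 1 / 2) := by
    have h1 : (q : ℝ) ^ 2 ≤ ((N : ℝ) ^ ((k : ℝ) + 1 / 2)) ^ 2 := by
      rw [← Real.rpow_natCast ((N : ℝ) ^ ((k : ℝ) + 1 / 2)), ← Real.rpow_mul hNR.le]
      have : ((k : ℝ) + 1 / 2) * ((2 : ℕ) : ℝ) = ((2 * k + 1 : ℕ) : ℝ) := by push_cast; ring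
      rw [this, Real.rpow_natCast]
      exact_mod_cast hqN
    exact le_of_sq_le_sq h1 (by positivity)
  -- With `q ≤ N ^ (k + 1 / 2)` this threshold balances `N ^ k / t` against `N * q * t`; both are at
  -- most `N ^ (k + 3 / 4)`.
  set t : ℝ := (N : ℝ) ^ (-(3 / 4) : ℝ) with ht
  have ht0 : 0 < t := by positivity
  have htinv : 2 / t = 2 * (N : ℝ) ^ (3 / 4 : ℝ) := by
    rw [ht, Real.rpow_neg hNR.le, div_inv_eq_mul]
  set D : ℝ := Cd * ((N : ℝ) ^ k) ^ ε with hD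
  have hD0 : 0 ≤ D := by positivity
  have hdiv : ∀ n, 0 < n → n ≤ N ^ k → (n.divisors.card : ℝ) ≤ D := by
    intro n hn hnN
    refine (hCd n hn).trans ?_
    have : (n : ℝ) ≤ (N : ℝ) ^ k := by exact_mod_cast hnN
    rw [hD]
    gcongr
  have hDk : D ^ k = Cd ^ k * (N : ℝ) ^ (1 / 8 : ℝ) := by
    rw [hD, mul_pow]
    congr 1
    rw [← Real.rpow_natCast (N : ℝ), ← Real.rpow_mul hNR.le, ← Real.rpow_natCast,
      ← Real.rpow_mul hNR.le]
    congr 1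
    rw [hε]; field_simp
  set φ : ℕ → ℝ := fun m => linearBound N t (B * y * m) with hφ
  have hφ0 : φ 0 ≤ 3 * N := by
    refine (linearBound_le _).trans ?_
    rw [htinv]
    have := hpow (show (3 / 4 : ℝ) ≤ 1 by norm_num)
    rw [Real.rpow_one] at this
    linarith
  have hNk : (N : ℝ) ^ k = (N : ℝ) ^ (k : ℝ) := (Real.rpow_natCast _ _).symm
  have hsum : ∑ m ∈ Icc 1 (N ^ k), φ m ≤ (12 * b + 8) * (N : ℝ) ^ ((k : ℝ) + 3 / 4) := by
    refine (sum_linearBound_le hq haq hy ht0 hB0 N (N ^ k)).trans ?_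
    have e0 : 2 * ((N ^ k : ℕ) : ℝ) / t = 2 * (N : ℝ) ^ ((k : ℝ) + 3 / 4) := by
      rw [mul_div_right_comm, htinv, Real.rpow_add hNR, ← hNk]; push_cast; ring
    have e1 : N * ((N : ℝ) ^ k * t) ≤ (N : ℝ) ^ ((k : ℝ) + 3 / 4) := by
      rw [hNk, ht, ← Real.rpow_add hNR]
      nth_rewrite 1 [← Real.rpow_one (N : ℝ)]
      rw [← Real.rpow_add hNR]
      exact hpow (by linarith)
    have e2 : N * ((N : ℝ) ^ k / q) ≤ (N : ℝ) ^ ((k : ℝ) + 3 / 4) := by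
      calc N * ((N : ℝ) ^ k / q) ≤ N * ((N : ℝ) ^ k / (N : ℝ) ^ (1 / 2 : ℝ)) := by gcongr
        _ = (N : ℝ) ^ ((1 : ℝ) + (k - 1 / 2)) := by
          rw [hNk, ← Real.rpow_sub hNR, Real.rpow_add hNR, Real.rpow_one]
        _ ≤ _ := hpow (by linarith)
    have e3 : N * (q * t) ≤ (N : ℝ) ^ ((k : ℝ) + 3 / 4) := by
      calc N * (q * t) ≤ N * ((N : ℝ) ^ ((k : ℝ) + 1 / 2) * t) := by gcongr
        _ = (N : ℝ) ^ ((1 : ℝ) + (((k : ℝ) + 1 / 2) + -(3 / 4))) := by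
          rw [Real.rpow_add hNR 1, Real.rpow_add hNR ((k : ℝ) + 1 / 2), Real.rpow_one]
        _ ≤ _ := hpow (by linarith)
    have e4 : (N : ℝ) ≤ (N : ℝ) ^ ((k : ℝ) + 3 / 4) := by
      have h1 : (1 : ℝ) ≤ k := by exact_mod_cast hk
      have := hpow (show (1 : ℝ) ≤ (k : ℝ) + 3 / 4 by linarith)
      rwa [Real.rpow_one] at this
    rw [e0]
    push_cast
    have e5 : (N : ℝ) * ((2 * (|(B : ℝ)| * (N : ℝ) ^ k) / q + 1) * (4 * q * t + 2))
        = 8 * b * (N * ((N : ℝ) ^ k * t)) + 4 * b * (N * ((N : ℝ) ^ k / q)) + 4 * (N * (q * t))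
          + 2 * N := by
      have : |(B : ℝ)| = b := by rw [hb]; push_cast; rfl
      rw [this]
      field_simp
      ring
    rw [e5]
    have f1 := mul_le_mul_of_nonneg_left e1 (show 0 ≤ 8 * b by positivity)
    have f2 := mul_le_mul_of_nonneg_left e2 (show 0 ≤ 4 * b by positivity)
    linarith
  have hU : sumProd N k φ ≤ C₁ * (N : ℝ) ^ ((k : ℝ) + 7 / 8) := by
    refine (sumProd_le hN k hD0 hdiv fun m => linearBound_nonneg ht0 _).trans ?_
    rw [hC₁, add_mul]
    refine add_le_add ?_ ?_
    · calc (k : ℝ) * ((N : ℝ) ^ k / N) * φ 0 ≤ k * ((N : ℝ) ^ k / N) * (3 * N) := by gcongr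
        _ = 3 * k * (N : ℝ) ^ (k : ℝ) := by rw [← hNk]; field_simp
        _ ≤ _ := by
          have := hpow (show (k : ℝ) ≤ (k : ℝ) + 7 / 8 by linarith)
          gcongr
    · calc D ^ k * ∑ m ∈ Icc 1 (N ^ k), φ m
          ≤ D ^ k * ((12 * b + 8) * (N : ℝ) ^ ((k : ℝ) + 3 / 4)) := by gcongr
        _ = Cd ^ k * (12 * b + 8) * (N : ℝ) ^ ((1 / 8 : ℝ) + ((k : ℝ) + 3 / 4)) := by
          rw [hDk, Real.rpow_add hNR (1 / 8)]; ring
        _ = _ := by congr 2; ring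
  have hweyl := weyl_differencing hN ht0 k P hdeg M hMN
  have hφeq : (fun m : ℕ => linearBound N t ((k + 1).factorial * P.coeff (k + 1) * m)) = φ := by
    funext m
    rw [hφ, hcoeff, hB]
    push_cast
    ring_nf
  rw [hφeq] at hweyl
  set S : ℝ := ‖∑ n ∈ range M, ee (P.eval (n : ℝ))‖ with hS
  obtain ⟨e, he⟩ : ∃ e, 2 ^ k = e + 1 := ⟨2 ^ k - 1, by have : 0 < 2 ^ k := by positivity
                                                        omega⟩
  have heR : (2 : ℝ) ^ k = e + 1 := by exact_mod_cast he
  have hSpow : S ^ 2 ^ k ≤ C * (N : ℝ) ^ ((e : ℝ) + 7 / 8) := by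
    have h1 : (N : ℝ) ^ k * S ^ 2 ^ k ≤ (N : ℝ) ^ k * (C * (N : ℝ) ^ ((e : ℝ) + 7 / 8)) := by
      refine hweyl.trans ((mul_le_mul_of_nonneg_left hU (by positivity)).trans_eq ?_)
      rw [hC, mul_pow, he, Nat.add_sub_cancel, Real.rpow_add hNR, Real.rpow_add hNR (e : ℝ),
        Real.rpow_natCast, Real.rpow_natCast]
      ring
    exact le_of_mul_le_mul_left h1 (by positivity)
  refine le_of_pow_le_pow_left₀ (n := 2 ^ k) (by positivity) (by positivity) (hSpow.trans ?_)
  rw [mul_pow, ← Real.rpow_natCast ((N : ℝ) ^ _), ← Real.rpow_mul hNR.le]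
  have h2 : (1 - 1 / (8 * 2 ^ k) : ℝ) * ((2 ^ k : ℕ) : ℝ) = (e : ℝ) + 7 / 8 := by
    push_cast
    rw [heR]
    have : (e : ℝ) + 1 ≠ 0 := by positivity
    field_simp
    ring
  rw [h2]
  gcongr
  exact le_self_pow₀ hC1 (by positivity)

/-! ### Growth of polynomials along the integers -/

theorem exists_bounds_eval_natCast {P : Polynomial ℝ} {n : ℕ} (hP : P.natDegree ≤ n)
    (hlead : 0 < P.coeff n) :
    ∃ c C : ℝ, 0 < c ∧ 0 < C ∧ ∃ N₀ : ℕ, ∀ m : ℕ, N₀ ≤ m →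
      c * (m : ℝ) ^ n ≤ P.eval (m : ℝ) ∧ P.eval (m : ℝ) ≤ C * (m : ℝ) ^ n := by
  have hdeg : P.natDegree = n := Polynomial.natDegree_eq_of_le_of_coeff_ne_zero hP hlead.ne'
  have hlc : P.leadingCoeff = P.coeff n := by rw [Polynomial.leadingCoeff, hdeg]
  have hP0 : P ≠ 0 := by rintro rfl; simp at hlead
  have ht := Polynomial.div_tendsto_atTop_leadingCoeff_div_of_degree_eq P (Polynomial.X ^ n) (by
    rw [Polynomial.degree_X_pow, Polynomial.degree_eq_natDegree hP0, hdeg])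
  rw [hlc, Polynomial.leadingCoeff_X_pow, div_one] at ht
  have ht' := ht.comp tendsto_natCast_atTop_atTop
  obtain ⟨N₁, h₁⟩ := eventually_atTop.1
    ((ht'.eventually (lt_mem_nhds (half_lt_self hlead))).and
      (ht'.eventually (gt_mem_nhds (show P.coeff n < 2 * P.coeff n by linarith))))
  refine ⟨P.coeff n / 2, 2 * P.coeff n, by positivity, by positivity, N₁ + 1, fun m hm => ?_⟩
  obtain ⟨h2, h3⟩ := h₁ m (by omega)
  have hm0 : (0 : ℝ) < (m : ℝ) ^ n := by
    have : (0 : ℝ) < m := by exact_mod_cast (by omega : 0 < m)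
    positivity
  simp only [Function.comp_apply, Polynomial.eval_pow, Polynomial.eval_X] at h2 h3
  rw [lt_div_iff₀ hm0] at h2
  rw [div_lt_iff₀ hm0] at h3
  exact ⟨h2.le, h3.le⟩

theorem coeff_taylor_top {P : Polynomial ℝ} {n : ℕ} (hP : P.natDegree ≤ n) (r : ℝ) :
    (Polynomial.taylor r P).coeff n = P.coeff n := by
  rw [Polynomial.taylor_coeff]
  have hd : (Polynomial.hasseDeriv n P).natDegree < 1 :=
    (Polynomial.natDegree_hasseDeriv_le P n).trans_lt (by omega)
  rw [Polynomial.eval_eq_sum_range' hd]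
  simp [Polynomial.hasseDeriv_coeff]

/-- The values of a polynomial at the natural numbers, together with the growth of its first
differences, which are eventually nondecreasing. -/
theorem exists_growth {P : Polynomial ℝ} {e : ℕ} (hP : P.natDegree ≤ e + 3)
    (hlead : 0 < P.coeff (e + 3)) :
    ∃ c C : ℝ, 0 < c ∧ 0 < C ∧ ∃ N₀ : ℕ, ∀ m : ℕ, N₀ ≤ m →
      |P.eval (m : ℝ)| ≤ C * (m : ℝ) ^ (e + 3) ∧
      c * (m : ℝ) ^ (e + 2) ≤ P.eval ((m + 1 : ℕ) : ℝ) - P.eval (m : ℝ) ∧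
      P.eval ((m + 1 : ℕ) : ℝ) - P.eval (m : ℝ) ≤ C * (m : ℝ) ^ (e + 2) ∧
      P.eval ((m + 1 : ℕ) : ℝ) - P.eval (m : ℝ) ≤
        P.eval ((m + 2 : ℕ) : ℝ) - P.eval ((m + 1 : ℕ) : ℝ) := by
  -- `Q` and `R` are the first and second differences; their positive leading coefficients give the
  -- growth and the eventual monotonicity of the increments.
  set Q := Polynomial.taylor 1 P - P with hQ
  have hQd : Q.natDegree ≤ e + 2 := natDegree_taylor_sub_le hP 1
  have hQc : 0 < Q.coeff (e + 2) := by
    rw [hQ, coeff_taylor_sub (k := e + 1) hP 1]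
    positivity
  set R := Polynomial.taylor 1 Q - Q with hR
  have hRd : R.natDegree ≤ e + 1 := natDegree_taylor_sub_le hQd 1
  have hRc : 0 < R.coeff (e + 1) := by
    rw [hR, coeff_taylor_sub (k := e) hQd 1]
    positivity
  have hQe : ∀ m : ℕ, Q.eval (m : ℝ) = P.eval ((m + 1 : ℕ) : ℝ) - P.eval (m : ℝ) := by
    intro m; simp [hQ, Polynomial.taylor_eval]
  have hRe : ∀ m : ℕ, R.eval (m : ℝ) = Q.eval ((m + 1 : ℕ) : ℝ) - Q.eval (m : ℝ) := by
    intro m; simp [hR, Polynomial.taylor_eval]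
  obtain ⟨c₁, C₁, hc₁, hC₁, N₁, h₁⟩ := exists_bounds_eval_natCast hP hlead
  obtain ⟨c₂, C₂, hc₂, hC₂, N₂, h₂⟩ := exists_bounds_eval_natCast hQd hQc
  obtain ⟨c₃, C₃, hc₃, hC₃, N₃, h₃⟩ := exists_bounds_eval_natCast hRd hRc
  refine ⟨c₂, C₁ + C₂, hc₂, by positivity, N₁ + N₂ + N₃, fun m hm => ?_⟩
  obtain ⟨a1, a2⟩ := h₁ m (by omega)
  obtain ⟨b1, b2⟩ := h₂ m (by omega)
  obtain ⟨d1, -⟩ := h₃ m (by omega)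
  have p1 : 0 ≤ (m : ℝ) ^ (e + 3) := by positivity
  have p2 : 0 ≤ (m : ℝ) ^ (e + 2) := by positivity
  have p3 : 0 ≤ c₃ * (m : ℝ) ^ (e + 1) := by positivity
  rw [hRe, hQe, hQe] at d1
  rw [hQe] at b1 b2
  refine ⟨?_, b1, by nlinarith, by linarith⟩
  rw [abs_of_nonneg (le_trans (by positivity) a1)]
  nlinarith

/-! ### Complete sums of odd integer polynomials -/

/-- The complete exponential sum `∑_{r < q} exp (2 π i a g(r) / q)`. -/
noncomputable def completeSum (g : Polynomial ℤ) (a : ℤ) (q : ℕ) : ℂ :=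
  ∑ r ∈ range q, ee (((g.eval (r : ℤ) : ℤ) : ℝ) * (a / q))

theorem ee_eval_congr (g : Polynomial ℤ) (a : ℤ) {q : ℕ} (hq : 0 < q) {m n : ℤ}
    (h : (q : ℤ) ∣ m - n) :
    ee (((g.eval m : ℤ) : ℝ) * (a / q)) = ee (((g.eval n : ℤ) : ℝ) * (a / q)) := by
  obtain ⟨b, hb⟩ := h.trans (Polynomial.sub_dvd_eval_sub m n g)
  have hqR : (q : ℝ) ≠ 0 := by exact_mod_cast hq.ne'
  have h1 : ((g.eval m : ℤ) : ℝ) = g.eval n + q * b := by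
    have : g.eval m = g.eval n + q * b := by linarith
    exact_mod_cast this
  rw [← ee_add_int (((g.eval n : ℤ) : ℝ) * (a / q)) (b * a), h1]
  congr 1
  push_cast
  field_simp

theorem eval_neg_of_odd {g : Polynomial ℤ} (hg : ∀ j : ℕ, Even j → g.coeff j = 0) (n : ℤ) :
    g.eval (-n) = -g.eval n := by
  rw [Polynomial.eval_eq_sum_range, Polynomial.eval_eq_sum_range, ← sum_neg_distrib]
  refine sum_congr rfl fun j _ => ?_
  rcases Nat.even_or_odd j with h | h
  · rw [hg j h]; simp
  · rw [h.neg_pow]; ring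

/-- Conjugation replaces `r` by `-r`, because `g` is odd, and this permutes the residues modulo `q`.
-/
theorem completeSum_im {g : Polynomial ℤ} (hg : ∀ j : ℕ, Even j → g.coeff j = 0) (a : ℤ)
    {q : ℕ} (hq : 0 < q) : (completeSum g a q).im = 0 := by
  set F : ℤ → ℂ := fun n => ee (((g.eval n : ℤ) : ℝ) * (a / q)) with hF
  have hsum : completeSum g a q = ∑ r ∈ range q, F (r : ℤ) := rfl
  have hconj : (starRingEnd ℂ) (completeSum g a q) = completeSum g a q := by
    rw [hsum, map_sum]
    have h1 : ∀ n : ℤ, (starRingEnd ℂ) (F n) = F (-n) := by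
      intro n
      simp only [hF, conj_ee, eval_neg_of_odd hg]
      push_cast; ring_nf
    -- Reflecting `range q` sends `r` to `q - 1 - r`, congruent to `-(r + 1)` and not to `-r`; the
    -- shift by one repairs this.
    have h2 : ∑ r ∈ range q, F ((r + 1 : ℕ) : ℤ) = ∑ r ∈ range q, F (r : ℤ) := by
      have h3 := sum_range_succ (fun r : ℕ => F (r : ℤ)) q
      have h4 := sum_range_succ' (fun r : ℕ => F (r : ℤ)) q
      have h5 : F (q : ℤ) = F ((0 : ℕ) : ℤ) := ee_eval_congr g a hq (by simp)
      rw [h3, h5] at h4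
      exact (add_right_cancel h4).symm
    rw [← sum_range_reflect, ← h2]
    refine sum_congr rfl fun r hr => ?_
    rw [mem_range] at hr
    rw [h1]
    refine ee_eval_congr g a hq ⟨-1, ?_⟩
    have : ((q - 1 - r : ℕ) : ℤ) = q - 1 - r := by omega
    rw [this]; push_cast; ring
  exact Complex.conj_eq_iff_im.1 hconj

theorem norm_sum_periodic_le {u : ℕ → ℂ} {q : ℕ} {K : ℝ} (hq : 0 < q)
    (hper : ∀ n, u (n + q) = u n) (h0 : ∑ n ∈ range q, u n = 0) (hK : ∀ n, ‖u n‖ ≤ K) (m : ℕ) :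
    ‖∑ n ∈ range m, u n‖ ≤ q * K := by
  have hK0 : 0 ≤ K := (norm_nonneg _).trans (hK 0)
  induction m using Nat.strong_induction_on with
  | _ m ih =>
    rcases lt_or_ge m q with h | h
    · refine (norm_sum_le_of_le _ fun n _ => hK n).trans ?_
      simp only [sum_const, card_range, nsmul_eq_mul]
      gcongr
    · obtain ⟨l, rfl⟩ : ∃ l, m = q + l := ⟨m - q, by omega⟩
      rw [sum_range_add, h0, zero_add]
      have : ∀ n, u (q + n) = u n := fun n => by rw [add_comm, hper]
      simp only [this]
      exact ih l (by omega)

/-- Comparison, near a rational `a / q`, of a sine sum over an odd integer polynomial with its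
major arc approximation. -/
theorem abs_sum_sin_le_major {g : Polynomial ℤ} (hg : ∀ j : ℕ, Even j → g.coeff j = 0) (a : ℤ)
    {q : ℕ} (hq : 0 < q) (β : ℝ) {N M : ℕ} {V : ℝ}
    (hV : ∀ k < M, |((g.eval ((N + (k + 1) : ℕ) : ℤ) : ℤ) : ℝ) - g.eval ((N + k : ℕ) : ℤ)| ≤ V) :
    |∑ k ∈ range M, Real.sin (2 * Real.pi * (((g.eval ((N + k : ℕ) : ℤ) : ℤ) : ℝ) * (a / q + β)))| ≤
      ‖completeSum g a q‖ / q *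
        |∑ k ∈ range M, Real.sin (2 * Real.pi * (((g.eval ((N + k : ℕ) : ℤ) : ℤ) : ℝ) * β))| +
      4 * q * (1 + 2 * Real.pi * |β| * (M * V)) := by
  have hqR : (0 : ℝ) < q := by exact_mod_cast hq
  set G := completeSum g a q with hG
  set F : ℕ → ℂ := fun n => ee (((g.eval (n : ℤ) : ℤ) : ℝ) * (a / q)) with hF
  -- Subtracting the mean over a period leaves bounded partial sums; the slowly varying `w` is then
  -- removed by summation by parts.
  set u : ℕ → ℂ := fun n => F n - G / q with hu
  set w : ℕ → ℂ := fun k => ee (((g.eval ((N + k : ℕ) : ℤ) : ℤ) : ℝ) * β) with hw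
  have hper : ∀ n, u (n + q) = u n := by
    intro n
    simp only [hu, hF]
    rw [ee_eval_congr g a hq (n := (n : ℤ)) (by simp)]
  have hqC : (q : ℂ) ≠ 0 := by exact_mod_cast hq.ne'
  have h0 : ∑ n ∈ range q, u n = 0 := by
    simp only [hu, sum_sub_distrib, sum_const, card_range, nsmul_eq_mul]
    rw [mul_div_cancel₀ _ hqC]
    exact sub_self _
  have hGn : ‖G‖ ≤ q := norm_sum_ee_le_card _ q
  have hK : ∀ n, ‖u n‖ ≤ 2 := by
    intro n
    refine (norm_sub_le _ _).trans ?_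
    have h1 : ‖F n‖ = 1 := norm_ee _
    have h2 : ‖G / q‖ ≤ 1 := by
      rw [norm_div, Complex.norm_natCast, div_le_one hqR]; exact hGn
    linarith
  have hB : ∀ m ≤ M, ‖∑ k ∈ range m, u (N + k)‖ ≤ 4 * q := by
    intro m _
    have h1 := norm_sum_periodic_le hq hper h0 hK (N + m)
    have h2 := norm_sum_periodic_le hq hper h0 hK N
    have h3 : ∑ k ∈ range m, u (N + k) = ∑ n ∈ range (N + m), u n - ∑ n ∈ range N, u n := by
      rw [sum_range_add]; ring
    rw [h3]
    refine (norm_sub_le _ _).trans ?_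
    linarith
  have hdecomp : ∑ k ∈ range M, ee (((g.eval ((N + k : ℕ) : ℤ) : ℤ) : ℝ) * (a / q + β))
      = ∑ k ∈ range M, w k * u (N + k) + (G / q) * ∑ k ∈ range M, w k := by
    rw [mul_sum, ← sum_add_distrib]
    refine sum_congr rfl fun k _ => ?_
    rw [mul_add, ee_add]
    simp only [hu, hw, hF]
    ring
  have hvar : ‖∑ k ∈ range M, w k * u (N + k)‖ ≤
      4 * q * (1 + 2 * Real.pi * |β| * (M * V)) := by
    refine (norm_sum_mul_le w (fun k => u (N + k)) M hB).trans ?_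
    refine mul_le_mul_of_nonneg_left (add_le_add (norm_ee _).le ?_) (by positivity)
    have hstep : ∀ k ∈ range (M - 1), ‖w (k + 1) - w k‖ ≤ 2 * Real.pi * |β| * V := by
      intro k hk
      rw [mem_range] at hk
      have h1 : w (k + 1) - w k = w k * (ee ((((g.eval ((N + (k + 1) : ℕ) : ℤ) : ℤ) : ℝ) -
          g.eval ((N + k : ℕ) : ℤ)) * β) - 1) := by
        rw [mul_sub, mul_one]
        simp only [hw]
        rw [← ee_add]
        ring_nf
      rw [h1, norm_mul, norm_ee, one_mul]
      refine (norm_ee_sub_one_le _).trans ?_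
      rw [abs_mul, mul_comm _ |β|, ← mul_assoc]
      exact mul_le_mul_of_nonneg_left (hV k (by omega)) (by positivity)
    refine (sum_le_sum hstep).trans ?_
    rw [sum_const, card_range, nsmul_eq_mul]
    rcases Nat.eq_zero_or_pos M with rfl | hM
    · simp
    have hV0 : 0 ≤ V := (abs_nonneg _).trans (hV 0 hM)
    have h2 : ((M - 1 : ℕ) : ℝ) ≤ M := by exact_mod_cast Nat.sub_le M 1
    calc ((M - 1 : ℕ) : ℝ) * (2 * Real.pi * |β| * V) ≤ M * (2 * Real.pi * |β| * V) := by gcongr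
      _ = _ := by ring
  -- Reality of `G` is decisive: otherwise a cosine sum would appear, which is as large as `M` when
  -- `β` is near 0.
  have him : ∑ k ∈ range M,
        Real.sin (2 * Real.pi * (((g.eval ((N + k : ℕ) : ℤ) : ℤ) : ℝ) * (a / q + β)))
      = (∑ k ∈ range M, w k * u (N + k)).im + G.re / q *
        ∑ k ∈ range M, Real.sin (2 * Real.pi * (((g.eval ((N + k : ℕ) : ℤ) : ℤ) : ℝ) * β)) := by
    have h1 := congrArg Complex.im hdecomp
    rw [Complex.im_sum] at h1
    simp only [ee_im] at h1
    rw [h1, Complex.add_im]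
    congr 1
    have hGi : G.im = 0 := completeSum_im hg a hq
    have hGq : G / q = ((G.re / q : ℝ) : ℂ) := by
      apply Complex.ext
      · rw [Complex.div_natCast_re, Complex.ofReal_re]
      · rw [Complex.div_natCast_im, hGi, zero_div, Complex.ofReal_im]
    rw [hGq, Complex.im_ofReal_mul, Complex.im_sum]
    simp only [hw, ee_im]
  rw [him, add_comm]
  refine (abs_add_le _ _).trans (add_le_add ?_ ((Complex.abs_im_le_norm _).trans hvar))
  rw [abs_mul, abs_div, abs_of_pos hqR]
  gcongr
  exact Complex.abs_re_le_norm G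

/-! ### Summation over the scales -/

/-- Group the scales by the value of `r j`. Within a group the minima have bounded sum; distinct
groups have denominators in distinct dyadic ranges, so the factors `den ^ (-δ)` are dominated by a
geometric series. -/
theorem sum_rpow_den_mul_min_le (y : ℝ) (r : ℕ → ℚ) (J : Finset ℕ) {ρ δ : ℝ} (hρ : 1 < ρ)
    (hδ : 0 < δ) (hsep : ∀ i ∈ J, ∀ j ∈ J, r i ≠ r j →
      Nat.log 2 (r i).den ≠ Nat.log 2 (r j).den) :
    ∑ j ∈ J, ((r j).den : ℝ) ^ (-δ) * min (ρ ^ j * |y - r j|) (1 / (ρ ^ j * |y - r j|)) ≤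
      2 * (ρ + 1) / (ρ - 1) * (1 - (2 : ℝ) ^ (-δ))⁻¹ := by
  classical
  have hρ1 : 0 < ρ - 1 := by linarith
  have hx0 : (0 : ℝ) < (2 : ℝ) ^ (-δ) := by positivity
  have hx1 : (2 : ℝ) ^ (-δ) < 1 := Real.rpow_lt_one_of_one_lt_of_neg one_lt_two (by linarith)
  have hmaps : ∀ j ∈ J, r j ∈ J.image r := fun j hj => mem_image_of_mem r hj
  rw [← sum_fiberwise_of_maps_to hmaps]
  have hfib : ∀ s ∈ J.image r, ∑ j ∈ J with r j = s,
      ((r j).den : ℝ) ^ (-δ) * min (ρ ^ j * |y - r j|) (1 / (ρ ^ j * |y - r j|)) ≤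
      2 * (ρ + 1) / (ρ - 1) * ((2 : ℝ) ^ (-δ)) ^ Nat.log 2 s.den := by
    intro s _
    have h1 : ∑ j ∈ J with r j = s,
        ((r j).den : ℝ) ^ (-δ) * min (ρ ^ j * |y - r j|) (1 / (ρ ^ j * |y - r j|))
        = (s.den : ℝ) ^ (-δ) *
          ∑ j ∈ J with r j = s, min (ρ ^ j * |y - s|) (1 / (ρ ^ j * |y - s|)) := by
      rw [mul_sum]
      exact sum_congr rfl fun j hj => by rw [(mem_filter.1 hj).2]
    have h2 : ∑ j ∈ J with r j = s, min (ρ ^ j * |y - s|) (1 / (ρ ^ j * |y - s|)) ≤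
        2 * (ρ + 1) / (ρ - 1) := by
      refine le_trans ?_ (sum_min_geometric_le hρ (abs_nonneg (y - s)) (J.sup id + 1))
      refine sum_le_sum_of_subset_of_nonneg ?_ fun j _ _ => by positivity
      intro j hj
      rw [mem_range]
      exact Nat.lt_succ_of_le (le_sup (f := id) (mem_filter.1 hj).1)
    have h3 : (s.den : ℝ) ^ (-δ) ≤ ((2 : ℝ) ^ (-δ)) ^ Nat.log 2 s.den := by
      rw [← Real.rpow_natCast, ← Real.rpow_mul (by norm_num), mul_comm,
        Real.rpow_mul (by norm_num), Real.rpow_natCast]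
      refine Real.rpow_le_rpow_of_nonpos (by positivity) ?_ (by linarith)
      exact_mod_cast Nat.pow_log_le_self 2 s.den_nz
    rw [h1, mul_comm]
    gcongr
  refine (sum_le_sum hfib).trans ?_
  rw [← mul_sum]
  refine mul_le_mul_of_nonneg_left ?_ (by positivity)
  have hinj : Set.InjOn (fun s : ℚ => Nat.log 2 s.den) (J.image r : Finset ℚ) := by
    intro s hs s' hs' h
    obtain ⟨i, hi, rfl⟩ := mem_image.1 (mem_coe.1 hs)
    obtain ⟨j, hj, rfl⟩ := mem_image.1 (mem_coe.1 hs')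
    by_contra hne
    exact hsep i hi j hj hne h
  rw [← sum_image (f := fun i => ((2 : ℝ) ^ (-δ)) ^ i) hinj, ← tsum_geometric_of_lt_one hx0.le hx1]
  exact (summable_geometric_of_lt_one hx0.le hx1).sum_le_tsum _ fun _ _ => by positivity

/-- The sums of `v` over initial parts of the blocks `[4 ^ j, 4 ^ (j + 1))`, `j ≥ j₀`, relative to
`4 ^ j`, are dominated by a nonnegative series with sum at most `C`. -/
def BlockBounded (j₀ : ℕ) (C : ℝ) (v : ℕ → ℝ) : Prop :=
  ∃ T : ℕ → ℝ, (∀ j, 0 ≤ T j) ∧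
    (∀ j, j₀ ≤ j → ∀ M, M ≤ 3 * 4 ^ j → |∑ k ∈ range M, v (4 ^ j + k)| ≤ 4 ^ j * T j) ∧
    ∀ J, ∑ j ∈ range J, T j ≤ C

theorem sum_pow_le {x : ℝ} (hx0 : 0 ≤ x) (hx1 : x < 1) (J : ℕ) :
    ∑ j ∈ range J, x ^ j ≤ (1 - x)⁻¹ := by
  rw [← tsum_geometric_of_lt_one hx0 hx1]
  exact (summable_geometric_of_lt_one hx0 hx1).sum_le_tsum _ fun _ _ => by positivity

/-! ### Sine sums with linear phase -/

theorem blockBounded_linear (θ : ℝ) :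
    BlockBounded 0 (24 * Real.pi * (2 * (4 + 1) / (4 - 1))) fun n =>
      Real.sin (2 * Real.pi * (n * θ)) := by
  have hpi := Real.pi_pos
  have ht0 : 0 ≤ distInt θ := abs_nonneg _
  refine ⟨fun j => 24 * Real.pi * min (4 ^ j * distInt θ) (1 / (4 ^ j * distInt θ)),
    fun j => by positivity, fun j _ M hM => ?_, fun J => ?_⟩
  · have hMR : (M : ℝ) ≤ 3 * 4 ^ j := by exact_mod_cast hM
    have h4 : (0 : ℝ) < 4 ^ j := by positivity
    have htriv : |∑ k ∈ range M, Real.sin (2 * Real.pi * (((4 ^ j + k : ℕ) : ℝ) * θ))| ≤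
        4 ^ j * (24 * Real.pi * (4 ^ j * distInt θ)) := by
      have hterm : ∀ k ∈ range M, |Real.sin (2 * Real.pi * (((4 ^ j + k : ℕ) : ℝ) * θ))| ≤
          8 * Real.pi * 4 ^ j * distInt θ := by
        intro k hk
        have hk' : ((4 ^ j + k : ℕ) : ℝ) ≤ 4 * 4 ^ j := by
          rw [mem_range] at hk
          have : 4 ^ j + k ≤ 4 * 4 ^ j := by omega
          exact_mod_cast this
        have h1 : 2 * Real.pi * (((4 ^ j + k : ℕ) : ℝ) * θ) =
            2 * Real.pi * (((4 ^ j + k : ℕ) : ℝ) * (θ - round θ)) +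
              (((4 ^ j + k : ℕ) : ℤ) * round θ : ℤ) * (2 * Real.pi) := by
          push_cast; ring
        rw [h1, Real.sin_add_int_mul_two_pi]
        refine Real.abs_sin_le_abs.trans ?_
        rw [abs_mul, abs_of_pos (by positivity : 0 < 2 * Real.pi), abs_mul, Nat.abs_cast]
        change 2 * Real.pi * (_ * distInt θ) ≤ _
        calc 2 * Real.pi * (((4 ^ j + k : ℕ) : ℝ) * distInt θ)
            ≤ 2 * Real.pi * ((4 * 4 ^ j) * distInt θ) := by gcongr
          _ = _ := by ring
      refine (abs_sum_le_sum_abs _ _).trans ((sum_le_sum hterm).trans ?_)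
      rw [sum_const, card_range, nsmul_eq_mul]
      calc (M : ℝ) * (8 * Real.pi * 4 ^ j * distInt θ)
          ≤ (3 * 4 ^ j) * (8 * Real.pi * 4 ^ j * distInt θ) := by gcongr
        _ = _ := by ring
    -- At distance 0 the convention `1 / 0 = 0` makes the minimum 0, which the trivial bound already
    -- attains. The same case split recurs below.
    rcases ht0.eq_or_lt with h0 | hpos
    · rw [← h0] at htriv ⊢
      simpa using htriv
    have hKL : |∑ k ∈ range M, Real.sin (2 * Real.pi * (((4 ^ j + k : ℕ) : ℝ) * θ))| ≤
        4 ^ j * (24 * Real.pi * (1 / (4 ^ j * distInt θ))) := by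
      have h1 := norm_sum_ee_linear_le (M := M) θ (4 ^ j * θ) hpos
      have h2 := (Complex.abs_im_le_norm _).trans h1
      rw [Complex.im_sum] at h2
      simp only [ee_im] at h2
      refine le_trans (le_of_eq ?_) (h2.trans ?_)
      · congr 1
        refine sum_congr rfl fun k _ => ?_
        push_cast
        ring_nf
      · have : 4 ^ j * (24 * Real.pi * (1 / (4 ^ j * distInt θ))) = 24 * Real.pi / distInt θ := by
          field_simp
        rw [this]
        gcongr
        linarith [Real.pi_gt_three]
    simp only
    rcases min_choice (4 ^ j * distInt θ) (1 / (4 ^ j * distInt θ)) with h | h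
    · rw [h]; exact htriv
    · rw [h]; exact hKL
  · rw [← mul_sum]
    exact mul_le_mul_of_nonneg_left (sum_min_geometric_le (by norm_num) ht0 J) (by positivity)

/-! ### Sine sums over odd polynomials of higher degree -/

theorem eval_map_intCast (g : Polynomial ℤ) (n : ℕ) :
    (g.map (Int.castRingHom ℝ)).eval (n : ℝ) = ((g.eval (n : ℤ) : ℤ) : ℝ) := by
  simp

/-- The increments of `g` near `N` have exact order `N ^ (e + 2)` and are nondecreasing. When `β`
keeps the phase increments below `1 / 2`, Kusmin–Landau applies; the trivial bound gives the other
entry of the minimum. -/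
theorem exists_slow_bound {g : Polynomial ℤ} {e : ℕ} (hdeg : g.natDegree = e + 3)
    (hlead : 0 < g.coeff (e + 3)) :
    ∃ C : ℝ, 0 < C ∧ ∃ N₀ : ℕ, ∀ N M : ℕ, N₀ ≤ N → M ≤ 3 * N →
      (∀ k < M, |((g.eval ((N + (k + 1) : ℕ) : ℤ) : ℤ) : ℝ) - g.eval ((N + k : ℕ) : ℤ)| ≤
        C * (N : ℝ) ^ (e + 2)) ∧
      ∀ β : ℝ, C * |β| * (N : ℝ) ^ (e + 2) ≤ 1 / 2 →
        |∑ k ∈ range M, Real.sin (2 * Real.pi * (((g.eval ((N + k : ℕ) : ℤ) : ℤ) : ℝ) * β))| ≤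
          N * (C * min ((N : ℝ) ^ (e + 3) * |β|) (1 / ((N : ℝ) ^ (e + 3) * |β|))) := by
  have hpi := Real.pi_pos
  obtain ⟨c, C, hc, hC, N₀, hgrow⟩ := exists_growth
    (P := g.map (Int.castRingHom ℝ)) (e := e) (Polynomial.natDegree_map_le.trans hdeg.le)
    (by rw [Polynomial.coeff_map]; simpa using hlead)
  simp only [eval_map_intCast] at hgrow
  set C' : ℝ := C * 4 ^ (e + 2) + 6 * Real.pi * C * 4 ^ (e + 3) + 2 / c with hC'
  have hp1 : 0 < C * 4 ^ (e + 2) := by positivity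
  have hp2 : 0 < 6 * Real.pi * C * 4 ^ (e + 3) := by positivity
  have hp3 : 0 < 2 / c := by positivity
  refine ⟨C', by positivity, N₀ + 1, fun N M hN hM => ?_⟩
  have hNR : (0 : ℝ) < N := by exact_mod_cast (by omega : 0 < N)
  have hNk : ∀ k < M, ((N + k : ℕ) : ℝ) ≤ 4 * N := by
    intro k hk
    exact_mod_cast (by omega : N + k ≤ 4 * N)
  have hkN : ∀ k, (N : ℝ) ≤ ((N + k : ℕ) : ℝ) := by
    intro k
    exact_mod_cast (by omega : N ≤ N + k)
  have hdiff : ∀ k < M, ((g.eval ((N + (k + 1) : ℕ) : ℤ) : ℤ) : ℝ) - g.eval ((N + k : ℕ) : ℤ) ≤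
      C * 4 ^ (e + 2) * (N : ℝ) ^ (e + 2) := by
    intro k hk
    refine ((hgrow (N + k) (by omega)).2.2.1).trans ?_
    have := hNk k hk
    calc C * ((N + k : ℕ) : ℝ) ^ (e + 2) ≤ C * (4 * N) ^ (e + 2) := by gcongr
      _ = _ := by rw [mul_pow]; ring
  have hdiff' : ∀ k, c * (N : ℝ) ^ (e + 2) ≤
      ((g.eval ((N + (k + 1) : ℕ) : ℤ) : ℤ) : ℝ) - g.eval ((N + k : ℕ) : ℤ) := by
    intro k
    refine le_trans ?_ (hgrow (N + k) (by omega)).2.1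
    have := hkN k
    gcongr
  refine ⟨fun k hk => ?_, fun β hβ => ?_⟩
  · rw [abs_of_nonneg (le_trans (by positivity) (hdiff' k))]
    refine (hdiff k hk).trans ?_
    gcongr
    linarith
  · have htriv : |∑ k ∈ range M,
        Real.sin (2 * Real.pi * (((g.eval ((N + k : ℕ) : ℤ) : ℤ) : ℝ) * β))| ≤
        N * (C' * ((N : ℝ) ^ (e + 3) * |β|)) := by
      have hterm : ∀ k ∈ range M,
          |Real.sin (2 * Real.pi * (((g.eval ((N + k : ℕ) : ℤ) : ℤ) : ℝ) * β))| ≤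
          2 * Real.pi * (C * (4 * N) ^ (e + 3) * |β|) := by
        intro k hk
        refine Real.abs_sin_le_abs.trans ?_
        rw [abs_mul, abs_of_pos (by positivity : 0 < 2 * Real.pi), abs_mul]
        have h1 := (hgrow (N + k) (by omega)).1
        have h2 := hNk k (mem_range.1 hk)
        have h3 : C * ((N + k : ℕ) : ℝ) ^ (e + 3) ≤ C * (4 * N) ^ (e + 3) := by gcongr
        have h4 := h1.trans h3
        gcongr
      refine (abs_sum_le_sum_abs _ _).trans ((sum_le_sum hterm).trans ?_)
      rw [sum_const, card_range, nsmul_eq_mul]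
      have hMR : (M : ℝ) ≤ 3 * N := by exact_mod_cast hM
      calc (M : ℝ) * (2 * Real.pi * (C * (4 * N) ^ (e + 3) * |β|))
          ≤ (3 * N) * (2 * Real.pi * (C * (4 * N) ^ (e + 3) * |β|)) := by gcongr
        _ = N * ((6 * Real.pi * C * 4 ^ (e + 3)) * ((N : ℝ) ^ (e + 3) * |β|)) := by
          rw [mul_pow]; ring
        _ ≤ _ := by gcongr; linarith
    rcases (abs_nonneg β).eq_or_lt with h0 | hpos
    · rw [← h0] at htriv ⊢
      simpa using htriv
    have hKL : |∑ k ∈ range M,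
        Real.sin (2 * Real.pi * (((g.eval ((N + k : ℕ) : ℤ) : ℤ) : ℝ) * β))| ≤
        N * (C' * (1 / ((N : ℝ) ^ (e + 3) * |β|))) := by
      have h1 : ‖∑ k ∈ range M, ee (((g.eval ((N + k : ℕ) : ℤ) : ℤ) : ℝ) * |β|)‖ ≤
          2 / (c * (N : ℝ) ^ (e + 2) * |β|) := by
        refine norm_sum_ee_le_of_monotone_diff (by positivity) (fun k hk => ?_) (fun k hk => ?_)
          (Or.inl fun k hk => ?_)
        · rw [← sub_mul]
          exact mul_le_mul_of_nonneg_right (hdiff' k) hpos.le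
        · rw [← sub_mul]
          refine (mul_le_mul_of_nonneg_right (hdiff k hk) hpos.le).trans (le_trans ?_ hβ)
          rw [mul_right_comm]
          gcongr
          linarith
        · rw [← sub_mul, ← sub_mul]
          exact mul_le_mul_of_nonneg_right (hgrow (N + k) (by omega)).2.2.2 hpos.le
      have h2 : ‖∑ k ∈ range M, ee (((g.eval ((N + k : ℕ) : ℤ) : ℤ) : ℝ) * β)‖ ≤
          2 / (c * (N : ℝ) ^ (e + 2) * |β|) := by
        rcases abs_cases β with ⟨h, -⟩ | ⟨h, -⟩
        · rwa [h] at h1 ⊢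
        · rw [← norm_sum_ee_neg]
          simp only [← mul_neg]
          rwa [h] at h1 ⊢
      have h3 := (Complex.abs_im_le_norm _).trans h2
      rw [Complex.im_sum] at h3
      simp only [ee_im] at h3
      refine h3.trans ?_
      have : 2 / (c * (N : ℝ) ^ (e + 2) * |β|) = N * (2 / c * (1 / ((N : ℝ) ^ (e + 3) * |β|))) := by
        rw [pow_succ _ (e + 2)]
        field_simp
      rw [this]
      gcongr
      linarith
    rcases min_choice ((N : ℝ) ^ (e + 3) * |β|) (1 / ((N : ℝ) ^ (e + 3) * |β|)) with h | h
    · rw [h]; exact htriv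
    · rw [h]; exact hKL

-- The major/minor arc dichotomy on a block of scale `4 ^ j`. The cutoff `2 * 2 ^ j` on the
-- denominator is about the square root of the length: below it the major arc error is `O(2 ^ j)`,
-- above it Weyl's inequality applies.
set_option maxHeartbeats 1000000 in
theorem exists_block_bound {g : Polynomial ℤ} {e : ℕ} (hdeg : g.natDegree = e + 3)
    (hlead : 0 < g.coeff (e + 3)) (hg : ∀ j : ℕ, Even j → g.coeff j = 0) :
    ∃ C δ : ℝ, 0 < C ∧ 0 < δ ∧ ∃ j₀ : ℕ, ∀ (y : ℝ) (j : ℕ), j₀ ≤ j → ∃ r : ℚ,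
      |y - r| ≤ 1 / (r.den * (2 ^ j) ^ (2 * e + 5)) ∧
      ∀ M, M ≤ 3 * 4 ^ j →
        |∑ k ∈ range M, Real.sin (2 * Real.pi * (((g.eval ((4 ^ j + k : ℕ) : ℤ) : ℤ) : ℝ) * y))| ≤
        4 ^ j * (C * (((4 : ℝ) ^ (-δ)) ^ j + (1 / 2) ^ j) + if r.den ≤ 2 * 2 ^ j then
          C * ((r.den : ℝ) ^ (-δ) *
            min ((4 ^ (e + 3)) ^ j * |y - r|) (1 / ((4 ^ (e + 3)) ^ j * |y - r|))) else 0) := by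
  have hpi := Real.pi_pos
  obtain ⟨Cw, δ, hCw, hδ, hweyl⟩ := weyl_inequality (k := e + 2) (by omega) hlead.ne'
  obtain ⟨Cs, hCs, N₀, hslow⟩ := exists_slow_bound hdeg hlead
  obtain ⟨n₀, hn₀⟩ := exists_nat_ge (2 * Cs)
  set C : ℝ := 3 * Cw + Cw * Cs + 8 * (1 + 6 * Real.pi * Cs) with hC
  have hC0 : 0 < C := by positivity
  have hp1 : 0 < Cw * Cs := by positivity
  have hp2 : 0 < 8 * (1 + 6 * Real.pi * Cs) := by positivity
  set G := g.map (Int.castRingHom ℝ) with hG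
  have hGdeg : G.natDegree ≤ e + 3 := Polynomial.natDegree_map_le.trans hdeg.le
  have hGc : G.coeff (e + 3) = (g.coeff (e + 3) : ℝ) := by rw [hG, Polynomial.coeff_map]; rfl
  refine ⟨C, δ, hC0, hδ, N₀ + n₀, fun y j hj => ?_⟩
  have hH0 : 0 < 2 ^ j := by positivity
  -- Dirichlet approximation with denominators up to `N ^ (d - 1 / 2)`, where `N = 4 ^ j` and `d = e
  -- + 3`: the upper limit allowed by `weyl_inequality` with `k = d - 1`.
  obtain ⟨r, hr, hden⟩ := Real.exists_rat_abs_sub_le_and_den_le y (n := (2 ^ j) ^ (2 * e + 5))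
    (by positivity)
  have hq : 0 < r.den := r.den_pos
  have hqR : (0 : ℝ) < r.den := by exact_mod_cast hq
  have hHR : (0 : ℝ) < 2 ^ j := by positivity
  have hr' : |y - r| ≤ 1 / (r.den * (2 ^ j) ^ (2 * e + 5)) := by
    refine hr.trans ?_
    push_cast
    refine one_div_le_one_div_of_le (by positivity) ?_
    nlinarith
  refine ⟨r, hr', fun M hM => ?_⟩
  have hcop : IsCoprime r.num (r.den : ℤ) := by
    rw [Int.isCoprime_iff_gcd_eq_one]
    exact r.reduced
  have hrdef : (r : ℝ) = r.num / r.den := Rat.cast_def r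
  have h4R : (0 : ℝ) < 4 ^ j := by positivity
  have h42 : (4 : ℝ) ^ j = 2 ^ j * 2 ^ j := by rw [← mul_pow]; norm_num
  have h42N : 4 ^ j = 2 ^ j * 2 ^ j := by rw [← mul_pow]; norm_num
  have hδpow : ((4 : ℝ) ^ j) ^ (1 - δ) = 4 ^ j * ((4 : ℝ) ^ (-δ)) ^ j := by
    rw [sub_eq_add_neg, Real.rpow_add h4R, Real.rpow_one, ← Real.rpow_natCast,
      ← Real.rpow_natCast, ← Real.rpow_mul (by norm_num), ← Real.rpow_mul (by norm_num), mul_comm (-δ)]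
  split_ifs with hmaj
  · set β := y - r with hβ
    have hyβ : y = r.num / r.den + β := by rw [hβ, ← hrdef]; ring
    have hjN : N₀ ≤ 4 ^ j := by
      have := Nat.lt_pow_self (show 1 < 4 by norm_num) (n := j)
      omega
    obtain ⟨hV, hsin⟩ := hslow (4 ^ j) M hjN hM
    have hβ1 : |β| * (2 ^ j) ^ (2 * e + 5) ≤ 1 / r.den := by
      have h1 := mul_le_mul_of_nonneg_right hr' (show (0 : ℝ) ≤ (2 ^ j) ^ (2 * e + 5) by positivity)
      refine h1.trans_eq ?_
      field_simp
    have hpw1 : ((4 : ℝ) ^ j) ^ (e + 2) * 2 ^ j = (2 ^ j) ^ (2 * e + 5) := by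
      rw [h42]; ring
    have hpw2 : ((4 : ℝ) ^ j) ^ (e + 3) = (2 ^ j) ^ (2 * e + 5) * 2 ^ j := by
      rw [h42]; ring
    have hq1 : 1 / (r.den : ℝ) ≤ 1 := by
      rw [div_le_one hqR]; exact_mod_cast hq
    have hβ2 : Cs * |β| * ((4 ^ j : ℕ) : ℝ) ^ (e + 2) ≤ 1 / 2 := by
      push_cast
      have h1 : |β| * ((4 : ℝ) ^ j) ^ (e + 2) * 2 ^ j ≤ 1 := by
        rw [mul_assoc, hpw1]; linarith
      have h2 : 2 * Cs ≤ 2 ^ j := by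
        refine hn₀.trans ?_
        have := Nat.lt_pow_self (show 1 < 2 by norm_num) (n := j)
        exact_mod_cast (by omega : n₀ ≤ 2 ^ j)
      have h3 : 0 ≤ |β| * ((4 : ℝ) ^ j) ^ (e + 2) := by positivity
      nlinarith
    have hs := hsin β hβ2
    have hm := abs_sum_sin_le_major hg r.num hq β hV
    rw [← hyβ] at hm
    refine hm.trans ?_
    push_cast at hs hm ⊢
    -- A complete sum is a Weyl sum of length `q` at the point `a / q` itself.
    have hgauss : ‖completeSum g r.num r.den‖ / r.den ≤ Cw * (r.den : ℝ) ^ (-δ) := by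
      have h1 := hweyl (r.num / r.den) (Polynomial.C (r.num / r.den : ℝ) * G) r.num r.den r.den
        r.den ((Polynomial.natDegree_C_mul_le _ _).trans hGdeg)
        (by rw [Polynomial.coeff_C_mul, hGc, mul_comm]) hq hcop (by simp) hq
        (Nat.le_self_pow (by norm_num) _) (Nat.pow_le_pow_right hq (by omega)) le_rfl
      rw [div_le_iff₀ hqR]
      refine le_trans (le_of_eq ?_) (h1.trans_eq ?_)
      · rw [completeSum]
        congr 1
        refine sum_congr rfl fun k _ => ?_
        rw [Polynomial.eval_mul, Polynomial.eval_C, hG, eval_map_intCast, mul_comm]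
      · rw [sub_eq_add_neg, Real.rpow_add hqR, Real.rpow_one]; ring
    have hpw3 : ((4 : ℝ) ^ j) ^ (e + 3) = (4 ^ (e + 3)) ^ j := by rw [← pow_mul, ← pow_mul, mul_comm]
    rw [hpw3] at hs
    set mn := min ((4 ^ (e + 3)) ^ j * |β|) (1 / ((4 ^ (e + 3)) ^ j * |β|)) with hmn
    have hmn0 : 0 ≤ mn := by positivity
    have hmain := mul_le_mul hgauss hs (abs_nonneg _) (by positivity)
    have herr : 4 * (r.den : ℝ) * (1 + 2 * Real.pi * |β| * (M * (Cs * (4 ^ j) ^ (e + 2)))) ≤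
        8 * (1 + 6 * Real.pi * Cs) * 2 ^ j := by
      have hMR : (M : ℝ) ≤ 3 * 4 ^ j := by exact_mod_cast hM
      have hq2 : (r.den : ℝ) ≤ 2 * 2 ^ j := by exact_mod_cast hmaj
      have h1 : (r.den : ℝ) * (|β| * (4 ^ j) ^ (e + 3)) ≤ 2 ^ j := by
        rw [hpw2, ← mul_assoc |β|]
        calc (r.den : ℝ) * (|β| * (2 ^ j) ^ (2 * e + 5) * 2 ^ j)
            ≤ r.den * (1 / r.den * 2 ^ j) := by gcongr
          _ = 2 ^ j := by field_simp
      calc 4 * (r.den : ℝ) * (1 + 2 * Real.pi * |β| * (M * (Cs * (4 ^ j) ^ (e + 2))))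
          ≤ 4 * (r.den : ℝ) * (1 + 2 * Real.pi * |β| * ((3 * 4 ^ j) * (Cs * (4 ^ j) ^ (e + 2)))) := by
            gcongr
        _ = 4 * r.den + 24 * Real.pi * Cs * (r.den * (|β| * (4 ^ j) ^ (e + 3))) := by ring
        _ ≤ 4 * (2 * 2 ^ j) + 24 * Real.pi * Cs * 2 ^ j := by gcongr
        _ ≤ _ := by
          have : 0 < Real.pi * Cs * 2 ^ j := by positivity
          linarith
    have h24 : (2 : ℝ) ^ j = 4 ^ j * (1 / 2) ^ j := by rw [← mul_pow]; norm_num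
    have hCs1 : 8 * (1 + 6 * Real.pi * Cs) * 2 ^ j ≤ 4 ^ j * (C * (1 / 2) ^ j) := by
      rw [h24]
      have : 8 * (1 + 6 * Real.pi * Cs) ≤ C := by linarith
      have h5 : (0 : ℝ) ≤ 4 ^ j * (1 / 2) ^ j := by positivity
      exact (mul_le_mul_of_nonneg_right this h5).trans_eq (by ring)
    have hCs2 : Cw * (r.den : ℝ) ^ (-δ) * (4 ^ j * (Cs * mn)) ≤
        4 ^ j * (C * ((r.den : ℝ) ^ (-δ) * mn)) := by
      have : Cw * Cs ≤ C := by linarith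
      have h5 : 0 ≤ 4 ^ j * ((r.den : ℝ) ^ (-δ) * mn) := by positivity
      calc Cw * (r.den : ℝ) ^ (-δ) * (4 ^ j * (Cs * mn))
          = Cw * Cs * (4 ^ j * ((r.den : ℝ) ^ (-δ) * mn)) := by ring
        _ ≤ C * (4 ^ j * ((r.den : ℝ) ^ (-δ) * mn)) := mul_le_mul_of_nonneg_right this h5
        _ = _ := by ring
    have hx : 0 ≤ 4 ^ j * (C * ((4 : ℝ) ^ (-δ)) ^ j) := by positivity
    refine (add_le_add (hmain.trans hCs2) (herr.trans hCs1)).trans ?_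
    linarith
  · push Not at hmaj
    have hqn : (r.den : ℝ) ≤ (2 ^ j) ^ (2 * e + 5) := by exact_mod_cast hden
    -- The length parameter is `3 * 4 ^ j`, which stays below `q ^ 2` because `q > 2 * 2 ^ j`.
    have hw := hweyl y (Polynomial.C y * Polynomial.taylor ((4 ^ j : ℕ) : ℝ) G) r.num r.den
      (3 * 4 ^ j) M
      ((Polynomial.natDegree_C_mul_le _ _).trans ((Polynomial.natDegree_taylor _ _).trans_le hGdeg))
      (by rw [Polynomial.coeff_C_mul, coeff_taylor_top hGdeg, hGc, mul_comm]) hq hcop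
      (by
        rw [← hrdef]
        refine hr'.trans (one_div_le_one_div_of_le (by positivity) ?_)
        rw [pow_two]
        gcongr)
      (by positivity) (by rw [h42N]; nlinarith)
      (by
        calc r.den ^ 2 ≤ ((2 ^ j) ^ (2 * e + 5)) ^ 2 := Nat.pow_le_pow_left hden 2
          _ = (4 ^ j) ^ (2 * (e + 2) + 1) := by rw [h42N]; ring
          _ ≤ _ := Nat.pow_le_pow_left (by omega) _)
      hM
    have h1 := (Complex.abs_im_le_norm _).trans hw
    rw [Complex.im_sum] at h1
    simp only [ee_im] at h1
    refine le_trans (le_of_eq ?_) (h1.trans ?_)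
    · congr 1
      refine sum_congr rfl fun k _ => ?_
      rw [Polynomial.eval_mul, Polynomial.eval_C, Polynomial.taylor_eval, ← Nat.cast_add, hG,
        eval_map_intCast, mul_comm y, add_comm k]
    · rw [add_zero]
      push_cast
      have h3 : ((3 : ℝ) * 4 ^ j) ^ (1 - δ) ≤ 3 * (4 ^ j) ^ (1 - δ) := by
        rw [Real.mul_rpow (by norm_num) h4R.le]
        gcongr
        calc (3 : ℝ) ^ (1 - δ) ≤ 3 ^ (1 : ℝ) :=
              Real.rpow_le_rpow_of_exponent_le (by norm_num) (by linarith)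
          _ = 3 := Real.rpow_one 3
      calc Cw * ((3 : ℝ) * 4 ^ j) ^ (1 - δ) ≤ Cw * (3 * (4 ^ j) ^ (1 - δ)) := by gcongr
        _ = 4 ^ j * (3 * Cw * ((4 : ℝ) ^ (-δ)) ^ j) := by rw [hδpow]; ring
        _ ≤ 4 ^ j * (C * (((4 : ℝ) ^ (-δ)) ^ j + (1 / 2) ^ j)) := by
          have hx : 0 ≤ ((4 : ℝ) ^ (-δ)) ^ j := by positivity
          have hz : (0 : ℝ) ≤ (1 / 2) ^ j := by positivity
          have : 3 * Cw ≤ C := by linarith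
          gcongr
          linarith

/-- Distinct fractions are at least `1 / (r.den * s.den)` apart, so `1 ≤ r.den / H' ^ n + s.den / H
^ n`. The first term is at most `1 / 2`, which forces `s.den ≥ H ^ n / 2 ≥ 8 * H`. -/
theorem two_mul_den_le {y : ℝ} {r s : ℚ} (hrs : r ≠ s) {H H' n : ℕ} (hn : 5 ≤ n) (hH : 2 ≤ H)
    (hHH' : 2 * H ≤ H') (hr : |y - r| ≤ 1 / (r.den * (H : ℝ) ^ n))
    (hs : |y - s| ≤ 1 / (s.den * (H' : ℝ) ^ n)) (hden : r.den ≤ 2 * H) :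
    2 * r.den ≤ s.den := by
  have hq : (0 : ℝ) < r.den := by exact_mod_cast r.den_pos
  have hq' : (0 : ℝ) < s.den := by exact_mod_cast s.den_pos
  have hHR : (2 : ℝ) ≤ H := by exact_mod_cast hH
  have hHR' : (2 : ℝ) * H ≤ H' := by exact_mod_cast hHH'
  have hdR : (r.den : ℝ) ≤ 2 * H := by exact_mod_cast hden
  have hint : (1 : ℝ) ≤ |((r.num * s.den - s.num * r.den : ℤ) : ℝ)| := by
    have : r.num * s.den - s.num * r.den ≠ 0 := by
      intro h
      exact hrs (Rat.eq_iff_mul_eq_mul.2 (by linarith))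
    exact_mod_cast Int.one_le_abs this
  have heq : ((r.num * s.den - s.num * r.den : ℤ) : ℝ)
      = r.den * s.den * ((y - s) - (y - r)) := by
    rw [Rat.cast_def r, Rat.cast_def s]
    push_cast
    field_simp
    ring
  have hpow : ∀ x : ℝ, 2 ≤ x → 16 * x ≤ x ^ n := by
    intro x hx
    calc 16 * x ≤ x ^ 4 * x := by
          gcongr
          calc (16 : ℝ) = 2 ^ 4 := by norm_num
            _ ≤ x ^ 4 := by gcongr
      _ = x ^ 5 := by ring
      _ ≤ x ^ n := pow_le_pow_right₀ (by linarith) hn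
  have h1 := hpow H hHR
  have h2 := hpow H' (by linarith)
  rw [heq, abs_mul, abs_of_pos (by positivity)] at hint
  have h3 : (1 : ℝ) ≤ r.den / (H' : ℝ) ^ n + s.den / (H : ℝ) ^ n := by
    have hp : (0 : ℝ) < (H : ℝ) ^ n := by linarith
    have hp' : (0 : ℝ) < (H' : ℝ) ^ n := by linarith
    calc (1 : ℝ) ≤ r.den * s.den * |(y - s) - (y - r)| := hint
      _ ≤ r.den * s.den * (1 / (s.den * (H' : ℝ) ^ n) + 1 / (r.den * (H : ℝ) ^ n)) := by
        gcongr
        exact (abs_sub _ _).trans (add_le_add hs hr)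
      _ = _ := by field_simp
  have h4 : (r.den : ℝ) / (H' : ℝ) ^ n ≤ 1 / 2 := by
    rw [div_le_div_iff₀ (by linarith) (by norm_num)]
    linarith
  have h5 : (1 : ℝ) / 2 ≤ s.den / (H : ℝ) ^ n := by linarith
  rw [div_le_div_iff₀ (by norm_num) (by linarith)] at h5
  have : (2 : ℝ) * r.den ≤ s.den := by linarith
  exact_mod_cast this

theorem exists_blockBounded_odd {g : Polynomial ℤ} {e : ℕ} (hdeg : g.natDegree = e + 3)
    (hlead : 0 < g.coeff (e + 3)) (hg : ∀ j : ℕ, Even j → g.coeff j = 0) :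
    ∃ (j₀ : ℕ) (C : ℝ), ∀ y : ℝ, BlockBounded j₀ C fun n =>
      Real.sin (2 * Real.pi * (((g.eval (n : ℤ) : ℤ) : ℝ) * y)) := by
  classical
  obtain ⟨C, δ, hC, hδ, j₀, h⟩ := exists_block_bound hdeg hlead hg
  set x : ℝ := (4 : ℝ) ^ (-δ) with hx
  have hx0 : 0 < x := by positivity
  have hx1 : x < 1 := Real.rpow_lt_one_of_one_lt_of_neg (by norm_num) (by linarith)
  have hρ : (1 : ℝ) < 4 ^ (e + 3) := one_lt_pow₀ (by norm_num) (by omega)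
  refine ⟨j₀ + 1, C * ((1 - x)⁻¹ + (1 - 1 / 2)⁻¹) + C * (2 * (4 ^ (e + 3) + 1) /
    (4 ^ (e + 3) - 1) * (1 - (2 : ℝ) ^ (-δ))⁻¹), fun y => ?_⟩
  choose! r hr hM using h y
  -- Starting at `j₀ + 1` ensures `2 ^ j ≥ 2`, as `two_mul_den_le` requires.
  refine ⟨fun j => C * (x ^ j + (1 / 2) ^ j) + if j₀ + 1 ≤ j ∧ (r j).den ≤ 2 * 2 ^ j then
    C * (((r j).den : ℝ) ^ (-δ) *
      min ((4 ^ (e + 3)) ^ j * |y - r j|) (1 / ((4 ^ (e + 3)) ^ j * |y - r j|))) else 0,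
    fun j => ?_, fun j hj M hMj => ?_, fun J => ?_⟩
  · simp only
    split_ifs <;> positivity
  · simp only [hj, true_and]
    exact hM j (by omega) M hMj
  · rw [sum_add_distrib, ← sum_filter, ← mul_sum, ← mul_sum, sum_add_distrib]
    refine add_le_add (mul_le_mul_of_nonneg_left (add_le_add (sum_pow_le hx0.le hx1 J)
      (sum_pow_le (by norm_num) (by norm_num) J)) hC.le) (mul_le_mul_of_nonneg_left ?_ hC.le)
    refine sum_rpow_den_mul_min_le y r _ hρ hδ ?_
    have hlt : ∀ i j, i < j → j₀ + 1 ≤ i → (r i).den ≤ 2 * 2 ^ i → r i ≠ r j →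
        Nat.log 2 (r i).den < Nat.log 2 (r j).den := by
      intro i j hij hi hd hne
      have h2 := two_mul_den_le (y := y) hne (H := 2 ^ i) (H' := 2 ^ j) (n := 2 * e + 5) (by omega)
        (by
          calc 2 = 2 ^ 1 := by norm_num
            _ ≤ 2 ^ i := Nat.pow_le_pow_right (by norm_num) (by omega))
        (by rw [← pow_succ']; exact Nat.pow_le_pow_right (by norm_num) hij)
        (by push_cast; exact hr i (by omega)) (by push_cast; exact hr j (by omega)) hd
      have h3 := Nat.log_mono_right (b := 2) h2
      rw [mul_comm, Nat.log_mul_base (by norm_num) (r i).den_nz] at h3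
      omega
    intro i hi j hj hne
    rw [mem_filter] at hi hj
    rcases lt_trichotomy i j with hij | rfl | hij
    · exact (hlt i j hij hi.2.1 hi.2.2 hne).ne
    · exact absurd rfl hne
    · exact (hlt j i hij hj.2.1 hj.2.2 hne.symm).ne'

theorem exists_int_polynomial (f : Polynomial ℚ) (hf : f ≠ 0) :
    ∃ (g : Polynomial ℤ) (b : ℤ), b ≠ 0 ∧ 0 < g.leadingCoeff ∧ g.natDegree = f.natDegree ∧
      (∀ j, (g.coeff j : ℚ) = b * f.coeff j) ∧
      ∀ n : ℕ, ((f.eval (n : ℚ) : ℚ) : ℝ) = ((g.eval (n : ℤ) : ℤ) : ℝ) / b := by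
  obtain ⟨b₀, hb₀mem, hb₀⟩ := IsLocalization.integerNormalization_spec (nonZeroDivisors ℤ) f
  have hb₀0 : b₀ ≠ 0 := nonZeroDivisors.ne_zero hb₀mem
  set g₀ := IsLocalization.integerNormalization (nonZeroDivisors ℤ) f with hg₀
  have hcoeff₀ : ∀ j, (g₀.coeff j : ℚ) = (b₀ : ℤ) * f.coeff j := by
    intro j
    have := congrArg (fun p => Polynomial.coeff p j) hb₀
    simpa using this
  have key : ∀ (g : Polynomial ℤ) (b : ℤ), b ≠ 0 → (∀ j, (g.coeff j : ℚ) = b * f.coeff j) →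
      g.natDegree = f.natDegree ∧
      ∀ n : ℕ, ((f.eval (n : ℚ) : ℚ) : ℝ) = ((g.eval (n : ℤ) : ℤ) : ℝ) / b := by
    intro g b hb hgb
    have hbQ : (b : ℚ) ≠ 0 := by exact_mod_cast hb
    have hmap : g.map (Int.castRingHom ℚ) = Polynomial.C (b : ℚ) * f := by
      ext j
      rw [Polynomial.coeff_map, Polynomial.coeff_C_mul]
      simpa using hgb j
    constructor
    · rw [← Polynomial.natDegree_map_eq_of_injective (f := Int.castRingHom ℚ) Int.cast_injective g,
        hmap, Polynomial.natDegree_C_mul hbQ]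
    · intro n
      have h1 := congrArg (Polynomial.eval (n : ℚ)) hmap
      have h2 := Polynomial.eval_intCast_map (Int.castRingHom ℚ) g (n : ℤ)
      rw [Int.cast_natCast] at h2
      rw [h2, Polynomial.eval_mul, Polynomial.eval_C] at h1
      have h3 : f.eval (n : ℚ) = ((g.eval (n : ℤ) : ℤ) : ℚ) / b := by
        rw [eq_div_iff hbQ, mul_comm]; exact h1.symm
      rw [h3]; push_cast; rfl
  have hlc : g₀.leadingCoeff ≠ 0 := by
    rw [Polynomial.leadingCoeff, (key g₀ b₀ hb₀0 hcoeff₀).1]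
    intro h0
    have h1 := hcoeff₀ f.natDegree
    rw [h0, Int.cast_zero] at h1
    have h2 : (((b₀ : ℤ) : ℚ)) ≠ 0 := by exact_mod_cast hb₀0
    exact mul_ne_zero h2 (Polynomial.leadingCoeff_ne_zero.2 hf) h1.symm
  -- The growth estimates need a positive leading coefficient; the sign is moved into `b`.
  rcases lt_or_gt_of_ne hlc with hneg | hpos
  · have hc : ∀ j, ((-g₀).coeff j : ℚ) = ((-b₀ : ℤ) : ℚ) * f.coeff j := by
      intro j
      rw [Polynomial.coeff_neg]; push_cast; rw [hcoeff₀]; ring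
    obtain ⟨h1, h2⟩ := key (-g₀) (-b₀) (neg_ne_zero.2 hb₀0) hc
    exact ⟨-g₀, -b₀, neg_ne_zero.2 hb₀0, by rw [Polynomial.leadingCoeff_neg]; linarith, h1, hc, h2⟩
  · obtain ⟨h1, h2⟩ := key g₀ b₀ hb₀0 hcoeff₀
    exact ⟨g₀, b₀, hb₀0, hpos, h1, hcoeff₀, h2⟩

theorem exists_blockBounded_rat {f : Polynomial ℚ} (hodd : Odd f.natDegree)
    (hf : ∀ j : ℕ, Even j → f.coeff j = 0) :
    ∃ (j₀ : ℕ) (C : ℝ), ∀ x : ℝ, BlockBounded j₀ C fun n =>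
      Real.sin (((f.eval (n : ℚ) : ℚ) : ℝ) * x) := by
  have hpi := Real.pi_pos
  obtain ⟨m, hm⟩ := hodd
  rcases Nat.eq_zero_or_pos m with rfl | hm0
  · refine ⟨0, 24 * Real.pi * (2 * (4 + 1) / (4 - 1)), fun x => ?_⟩
    have h1 : ∀ n : ℕ, f.eval (n : ℚ) = f.coeff 1 * n := by
      intro n
      rw [Polynomial.eval_eq_sum_range' (n := 2) (by omega)]
      simp [sum_range_succ, hf 0 (by simp)]
    have h2 := blockBounded_linear ((f.coeff 1 : ℝ) * x / (2 * Real.pi))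
    have h3 : (fun n : ℕ => Real.sin (((f.eval (n : ℚ) : ℚ) : ℝ) * x)) = fun n : ℕ =>
        Real.sin (2 * Real.pi * (n * ((f.coeff 1 : ℝ) * x / (2 * Real.pi)))) := by
      funext n
      rw [h1]
      push_cast
      congr 1
      field_simp
    rw [h3]
    exact h2
  · have hf0 : f ≠ 0 := by rintro rfl; simp at hm
    obtain ⟨g, b, hb, hlead, hdeg, hcoeff, heval⟩ := exists_int_polynomial f hf0
    obtain ⟨e, he⟩ : ∃ e, f.natDegree = e + 3 := ⟨f.natDegree - 3, by omega⟩
    have hbR : (b : ℝ) ≠ 0 := by exact_mod_cast hb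
    obtain ⟨j₀, C, hB⟩ := exists_blockBounded_odd (hdeg.trans he)
      (by rwa [Polynomial.leadingCoeff, hdeg, he] at hlead)
      (fun j hj => by
        have := hcoeff j
        rw [hf j hj, mul_zero] at this
        exact_mod_cast this)
    refine ⟨j₀, C, fun x => ?_⟩
    have h3 : (fun n : ℕ => Real.sin (((f.eval (n : ℚ) : ℚ) : ℝ) * x)) = fun n : ℕ =>
        Real.sin (2 * Real.pi * (((g.eval (n : ℤ) : ℤ) : ℝ) * (x / (2 * Real.pi * b)))) := by
      funext n
      rw [heval]
      congr 1
      field_simp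
    rw [h3]
    exact hB _

/-! ### Differences of real powers -/

theorem exists_rpow_sub_eq (s : ℝ) {a b : ℝ} (ha : 0 < a) (hab : a < b) :
    ∃ ξ ∈ Set.Ioo a b, b ^ s - a ^ s = (b - a) * (s * ξ ^ (s - 1)) := by
  obtain ⟨ξ, hξ, h⟩ := exists_hasDerivAt_eq_slope (fun t : ℝ => t ^ s)
    (fun t => s * t ^ (s - 1)) hab
    (fun t ht => (Real.continuousAt_rpow_const t s (Or.inl (by linarith [ht.1]))).continuousWithinAt)
    (fun t ht => Real.hasDerivAt_rpow_const (Or.inl (by linarith [ht.1])))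
  refine ⟨ξ, hξ, ?_⟩
  rw [h]
  field_simp [sub_ne_zero.2 hab.ne']

/-- Used with `s = α - 1` and `s = α - 2`. The range reaches `5 * N` because differences overshoot
the block end `4 * N`. -/
theorem rpow_comparable {N ξ s : ℝ} (hN : 0 < N) (h1 : N ≤ ξ) (h2 : ξ ≤ 5 * N) (hs1 : -2 ≤ s)
    (hs2 : s ≤ 1) : N ^ s / 25 ≤ ξ ^ s ∧ ξ ^ s ≤ 5 * N ^ s := by
  have hρ1 : 1 ≤ ξ / N := by rwa [one_le_div hN]
  have hρ2 : ξ / N ≤ 5 := by rwa [div_le_iff₀ hN]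
  have hξ : ξ ^ s = (ξ / N) ^ s * N ^ s := by
    rw [← Real.mul_rpow (by linarith) hN.le, div_mul_cancel₀ _ hN.ne']
  have hNs : 0 < N ^ s := by positivity
  have hup : (ξ / N) ^ s ≤ 5 := by
    calc (ξ / N) ^ s ≤ (ξ / N) ^ (1 : ℝ) := Real.rpow_le_rpow_of_exponent_le hρ1 hs2
      _ ≤ 5 := by rwa [Real.rpow_one]
  have hlow : 1 / 25 ≤ (ξ / N) ^ s := by
    calc (1 : ℝ) / 25 = 5 ^ (-2 : ℝ) := by rw [Real.rpow_neg (by norm_num)]; norm_num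
      _ ≤ (ξ / N) ^ (-2 : ℝ) := Real.rpow_le_rpow_of_nonpos (by linarith) hρ2 (by norm_num)
      _ ≤ _ := Real.rpow_le_rpow_of_exponent_le hρ1 hs1
  rw [hξ]
  constructor
  · calc N ^ s / 25 = 1 / 25 * N ^ s := by ring
      _ ≤ _ := by gcongr
  · gcongr

theorem rpow_second_diff_nonneg {s t : ℝ} (hs : 1 ≤ s) (ht : 0 ≤ t) :
    (t + 1) ^ s - t ^ s ≤ (t + 2) ^ s - (t + 1) ^ s := by
  have h := (convexOn_rpow hs).2 (Set.mem_Ici.2 ht) (Set.mem_Ici.2 (by linarith : 0 ≤ t + 2))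
    (show (0 : ℝ) ≤ 1 / 2 by norm_num) (show (0 : ℝ) ≤ 1 / 2 by norm_num) (by norm_num)
  simp only [smul_eq_mul] at h
  rw [show 1 / 2 * t + 1 / 2 * (t + 2) = t + 1 by ring] at h
  linarith

theorem rpow_second_diff_nonpos {s t : ℝ} (hs0 : 0 ≤ s) (hs : s ≤ 1) (ht : 0 ≤ t) :
    (t + 2) ^ s - (t + 1) ^ s ≤ (t + 1) ^ s - t ^ s := by
  have h := (Real.concaveOn_rpow hs0 hs).2 (Set.mem_Ici.2 ht)
    (Set.mem_Ici.2 (by linarith : 0 ≤ t + 2))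
    (show (0 : ℝ) ≤ 1 / 2 by norm_num) (show (0 : ℝ) ≤ 1 / 2 by norm_num) (by norm_num)
  simp only [smul_eq_mul] at h
  rw [show 1 / 2 * t + 1 / 2 * (t + 2) = t + 1 by ring] at h
  linarith

theorem hasDerivAt_rpow_add {s t a : ℝ} (ht : 0 < t + a) :
    HasDerivAt (fun t : ℝ => (t + a) ^ s) (s * (t + a) ^ (s - 1)) t := by
  have h := (Real.hasDerivAt_rpow_const (x := t + a) (p := s) (Or.inl ht.ne')).comp_add_const t a
  exact h

/-- Mixed second differences of `t ↦ t ^ s`. -/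
theorem exists_rpow_mixed_diff_eq (s : ℝ) {t h : ℝ} (ht : 0 < t) (hh : 0 < h) :
    ∃ ξ, t < ξ ∧ ξ < t + h + 1 ∧
      ((t + h + 1) ^ s - (t + h) ^ s) - ((t + 1) ^ s - t ^ s) =
        h * (s * ((s - 1) * ξ ^ (s - 2))) := by
  obtain ⟨η, hη, h1⟩ := exists_hasDerivAt_eq_slope
    (fun t : ℝ => (t + 1) ^ s - (t + 0) ^ s)
    (fun t => s * (t + 1) ^ (s - 1) - s * (t + 0) ^ (s - 1)) (show t < t + h by linarith)
    (fun u hu => ((hasDerivAt_rpow_add (by linarith [hu.1])).sub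
      (hasDerivAt_rpow_add (by linarith [hu.1]))).continuousAt.continuousWithinAt)
    (fun u hu => (hasDerivAt_rpow_add (by linarith [hu.1])).sub
      (hasDerivAt_rpow_add (by linarith [hu.1])))
  simp only [add_zero] at h1
  obtain ⟨ξ, hξ, h2⟩ := exists_rpow_sub_eq (s - 1) (show 0 < η by linarith [hη.1])
    (show η < η + 1 by linarith)
  refine ⟨ξ, hη.1.trans hξ.1, by linarith [hη.2, hξ.2], ?_⟩
  rw [← mul_sub, h2, add_sub_cancel_left, add_sub_cancel_left, one_mul, eq_div_iff hh.ne'] at h1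
  rw [← h1, show s - 1 - 1 = s - 2 by ring]
  ring

/-- Mixed second differences of `t ↦ t ^ s`, `1 ≤ s ≤ 2`, are nonincreasing. -/
theorem rpow_mixed_diff_antitone {s t h : ℝ} (hs1 : 1 ≤ s) (hs2 : s ≤ 2) (ht : 0 < t)
    (hh : 0 < h) :
    ((t + h + 2) ^ s - (t + h + 1) ^ s) - ((t + 2) ^ s - (t + 1) ^ s) ≤
      ((t + h + 1) ^ s - (t + h) ^ s) - ((t + 1) ^ s - t ^ s) := by
  have hder : ∀ u, 0 < u → HasDerivAt
      (fun u : ℝ => ((u + 2) ^ s - (u + 1) ^ s) - ((u + 1) ^ s - (u + 0) ^ s))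
      ((s * (u + 2) ^ (s - 1) - s * (u + 1) ^ (s - 1)) -
        (s * (u + 1) ^ (s - 1) - s * (u + 0) ^ (s - 1))) u := fun u hu =>
    ((hasDerivAt_rpow_add (by linarith)).sub (hasDerivAt_rpow_add (by linarith))).sub
      ((hasDerivAt_rpow_add (by linarith)).sub (hasDerivAt_rpow_add (by linarith)))
  obtain ⟨η, hη, h1⟩ := exists_hasDerivAt_eq_slope _ _ (show t < t + h by linarith)
    (fun u hu => (hder u (by linarith [hu.1])).continuousAt.continuousWithinAt)
    (fun u hu => hder u (by linarith [hu.1]))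
  simp only [add_zero] at h1
  rw [add_sub_cancel_left, eq_div_iff hh.ne'] at h1
  -- After the mean value theorem in `h`, what remains is the concavity of the power `s - 1`, which
  -- lies in `[0, 1]`.
  have h2 := rpow_second_diff_nonpos (s := s - 1) (by linarith) (by linarith)
    (show 0 ≤ η by linarith [hη.1])
  have h3 : (s * (η + 2) ^ (s - 1) - s * (η + 1) ^ (s - 1) -
      (s * (η + 1) ^ (s - 1) - s * η ^ (s - 1))) * h ≤ 0 := by
    refine mul_nonpos_of_nonpos_of_nonneg ?_ hh.le
    have : s * ((η + 2) ^ (s - 1) - (η + 1) ^ (s - 1)) ≤ s * ((η + 1) ^ (s - 1) - η ^ (s - 1)) := by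
      gcongr
    linarith
  linarith

/-! ### Sums with phase `θ n ^ α` -/

/-- The phase increments are comparable to `α * θ * N ^ (α - 1)`, and `hslow` keeps them below `1 /
2`. They are monotone by convexity for `α ≥ 1` and by concavity for `α ≤ 1`. -/
theorem norm_sum_rpow_le_of_slow {α θ : ℝ} (hα0 : 0 < α) (hα2 : α < 2) (hθ : 0 < θ) {N M : ℕ}
    (hN : 0 < N) (hM : M ≤ 3 * N) (hslow : 10 * α * θ * (N : ℝ) ^ (α - 1) ≤ 1) :
    ‖∑ k ∈ range M, ee (((N + k : ℕ) : ℝ) ^ α * θ)‖ ≤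
      N * (50 / α * (1 / ((N : ℝ) ^ α * θ))) := by
  have hNR : (0 : ℝ) < N := by exact_mod_cast hN
  have hb : ∀ k < M, (N : ℝ) ^ (α - 1) / 25 * α ≤
      ((N + (k + 1) : ℕ) : ℝ) ^ α - ((N + k : ℕ) : ℝ) ^ α ∧
      ((N + (k + 1) : ℕ) : ℝ) ^ α - ((N + k : ℕ) : ℝ) ^ α ≤ 5 * (N : ℝ) ^ (α - 1) * α := by
    intro k hk
    have h0 : (N : ℝ) ≤ ((N + k : ℕ) : ℝ) := by exact_mod_cast Nat.le_add_right N k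
    have h1 : ((N + (k + 1) : ℕ) : ℝ) ≤ 5 * N := by
      exact_mod_cast (by omega : N + (k + 1) ≤ 5 * N)
    have h2 : ((N + (k + 1) : ℕ) : ℝ) = ((N + k : ℕ) : ℝ) + 1 := by push_cast; ring
    obtain ⟨ξ, hξ, he⟩ := exists_rpow_sub_eq α (a := ((N + k : ℕ) : ℝ))
      (b := ((N + (k + 1) : ℕ) : ℝ)) (by linarith) (by linarith)
    have hc := rpow_comparable hNR (h0.trans hξ.1.le) (hξ.2.le.trans h1)
      (show -2 ≤ α - 1 by linarith) (by linarith)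
    rw [he, h2, add_sub_cancel_left, one_mul, mul_comm α]
    exact ⟨mul_le_mul_of_nonneg_right hc.1 hα0.le, mul_le_mul_of_nonneg_right hc.2 hα0.le⟩
  have hcast : ∀ k : ℕ, ((N + (k + 1) : ℕ) : ℝ) = ((N + k : ℕ) : ℝ) + 1 ∧
      ((N + (k + 2) : ℕ) : ℝ) = ((N + k : ℕ) : ℝ) + 2 := by
    intro k; constructor <;> push_cast <;> ring
  have h := norm_sum_ee_le_of_monotone_diff (φ := fun k => ((N + k : ℕ) : ℝ) ^ α * θ) (M := M)
    (lam := (N : ℝ) ^ (α - 1) / 25 * α * θ) (by positivity)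
    (fun k hk => by
      rw [← sub_mul]
      exact mul_le_mul_of_nonneg_right (hb k hk).1 hθ.le)
    (fun k hk => by
      rw [← sub_mul]
      refine (mul_le_mul_of_nonneg_right (hb k hk).2 hθ.le).trans ?_
      linarith)
    (by
      rcases le_total 1 α with h1 | h1
      · left
        intro k _
        rw [← sub_mul, ← sub_mul, (hcast k).1, (hcast k).2]
        exact mul_le_mul_of_nonneg_right (rpow_second_diff_nonneg h1 (by positivity)) hθ.le
      · right
        intro k _
        rw [← sub_mul, ← sub_mul, (hcast k).1, (hcast k).2]
        exact mul_le_mul_of_nonneg_right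
          (rpow_second_diff_nonpos hα0.le h1 (by positivity)) hθ.le)
  refine h.trans_eq ?_
  have hpow : (N : ℝ) ^ α = (N : ℝ) ^ (α - 1) * N := by
    rw [Real.rpow_sub_one hNR.ne', div_mul_cancel₀ _ hNR.ne']
  rw [hpow]
  have : (0 : ℝ) < (N : ℝ) ^ (α - 1) := by positivity
  field_simp
  norm_num

theorem norm_sum_le_of_pieces {a : ℕ → ℂ} {L : ℕ} (hL : 0 < L) {W : ℝ} (hW : 0 ≤ W) (M : ℕ) :
    (∀ s m, m ≤ L → s + m ≤ M → ‖∑ i ∈ range m, a (s + i)‖ ≤ W) →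
      ‖∑ k ∈ range M, a k‖ ≤ (M / L + 1) * W := by
  have hLR : (0 : ℝ) < L := by exact_mod_cast hL
  induction M using Nat.strong_induction_on with
  | _ M ih =>
    intro h
    rcases le_or_gt M L with hML | hML
    · have h1 := h 0 M hML (by omega)
      simp only [zero_add] at h1
      have h2 : (0 : ℝ) ≤ M / L := by positivity
      nlinarith
    · obtain ⟨l, rfl⟩ : ∃ l, M = l + L := ⟨M - L, by omega⟩
      rw [sum_range_add]
      refine (norm_add_le _ _).trans ?_
      have h1 := ih l (by omega) fun s m hm hsm => h s m hm (by omega)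
      have h2 := h l L le_rfl le_rfl
      have h3 : (((l + L : ℕ) : ℝ) / L + 1) * W = (l / L + 1) * W + W := by
        push_cast; field_simp
      rw [h3]
      exact add_le_add h1 h2

/-- A crude substitute for the logarithm, enough for a power saving; the term `h = 0` is 0 by
convention. -/
theorem sum_one_div_le_sqrt (L : ℕ) : ∑ h ∈ range L, (1 : ℝ) / (h : ℝ) ≤ 3 * √L := by
  induction L with
  | zero => simp
  | succ L ih =>
    rw [sum_range_succ]
    rcases Nat.eq_zero_or_pos L with rfl | hL
    · simp
    have hLR : (1 : ℝ) ≤ L := by exact_mod_cast hL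
    have hs1 : 1 ≤ √(L : ℝ) := Real.one_le_sqrt.2 hLR
    have hsq : √(L : ℝ) * √L = L := Real.mul_self_sqrt (by linarith)
    have hstep : √(L : ℝ) + 1 / (3 * L) ≤ √((L + 1 : ℕ) : ℝ) := by
      refine Real.le_sqrt_of_sq_le ?_
      push_cast
      have h1 : √(L : ℝ) * (1 / (3 * L)) ≤ 1 / 3 := by
        rw [mul_one_div, div_le_div_iff₀ (by positivity) (by norm_num)]
        nlinarith
      have h2 : (1 / (3 * L : ℝ)) ^ 2 ≤ 1 / 9 := by
        have : 1 / (3 * L : ℝ) ≤ 1 / 3 := one_div_le_one_div_of_le (by norm_num) (by linarith)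
        have h0 : 0 ≤ 1 / (3 * L : ℝ) := by positivity
        nlinarith
      nlinarith
    have : (1 : ℝ) / L = 3 * (1 / (3 * L)) := by field_simp
    rw [this]
    linarith

/-- A short sum with phase `θ n ^ α`, `1 < α < 2`, after one Weyl differencing. -/
theorem norm_sq_sum_rpow_short_le {α θ lam : ℝ} (hα1 : 1 < α) (hα2 : α < 2) (hθ : 0 < θ)
    {N L s m : ℕ} (hN : 0 < N) (hNs : N ≤ s) (hsm : s + m ≤ 4 * N) (hmL : m ≤ L)
    (hlam : lam = θ * (α * ((α - 1) * ((N : ℝ) ^ (α - 2) / 25)))) (hL : 250 * lam * L ≤ 1) :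
    ‖∑ i ∈ range m, ee (((s + i : ℕ) : ℝ) ^ α * θ)‖ ^ 2 ≤ 2 * (L + 6 * √L / lam) := by
  have hNR : (0 : ℝ) < N := by exact_mod_cast hN
  have hα' : 0 < α - 1 := by linarith
  have hlam0 : 0 < lam := by rw [hlam]; positivity
  refine (norm_sq_sum_ee_le (fun i => ((s + i : ℕ) : ℝ) ^ α * θ) hmL).trans ?_
  refine mul_le_mul_of_nonneg_left ?_ (by norm_num)
  -- The shift 0 is bounded trivially by `L`. For `h > 0` the differenced phase has increments
  -- between `lam * h` and `125 * lam * h`, and `hL` keeps the latter below `1 / 2`.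
  have hterm : ∀ h ∈ range L,
      ‖∑ i ∈ range (m - h), ee (((s + (i + h) : ℕ) : ℝ) ^ α * θ - ((s + i : ℕ) : ℝ) ^ α * θ)‖ ≤
      (if h = 0 then (L : ℝ) else 0) + 2 / lam * (1 / h) := by
    intro h hhL
    rw [mem_range] at hhL
    split_ifs with h0
    · refine (norm_sum_ee_le_card _ _).trans ?_
      subst h0
      simpa using hmL
    · rw [zero_add]
      have hhpos : 0 < h := Nat.pos_of_ne_zero h0
      have hhR : (0 : ℝ) < h := by exact_mod_cast hhpos
      have hcast : ∀ i : ℕ, ((s + (i + h) : ℕ) : ℝ) = ((s + i : ℕ) : ℝ) + h ∧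
          ((s + (i + 1) : ℕ) : ℝ) = ((s + i : ℕ) : ℝ) + 1 ∧
          ((s + (i + 2) : ℕ) : ℝ) = ((s + i : ℕ) : ℝ) + 2 ∧
          ((s + (i + 1 + h) : ℕ) : ℝ) = ((s + i : ℕ) : ℝ) + h + 1 ∧
          ((s + (i + 2 + h) : ℕ) : ℝ) = ((s + i : ℕ) : ℝ) + h + 2 := by
        intro i
        refine ⟨?_, ?_, ?_, ?_, ?_⟩ <;> push_cast <;> ring
      have hb : ∀ i < m - h, lam * h ≤
          ((((s + i : ℕ) : ℝ) + h + 1) ^ α - (((s + i : ℕ) : ℝ) + h) ^ α -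
            ((((s + i : ℕ) : ℝ) + 1) ^ α - ((s + i : ℕ) : ℝ) ^ α)) * θ ∧
          ((((s + i : ℕ) : ℝ) + h + 1) ^ α - (((s + i : ℕ) : ℝ) + h) ^ α -
            ((((s + i : ℕ) : ℝ) + 1) ^ α - ((s + i : ℕ) : ℝ) ^ α)) * θ ≤ 125 * lam * h := by
        intro i hi
        have h1 : (N : ℝ) ≤ ((s + i : ℕ) : ℝ) := by exact_mod_cast (by omega : N ≤ s + i)
        have h2 : ((s + i : ℕ) : ℝ) + h + 1 ≤ 5 * N := by
          exact_mod_cast (by omega : s + i + h + 1 ≤ 5 * N)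
        obtain ⟨ξ, hξ1, hξ2, he⟩ := exists_rpow_mixed_diff_eq α (t := ((s + i : ℕ) : ℝ))
          (h := (h : ℝ)) (by linarith) hhR
        have hc := rpow_comparable hNR (h1.trans hξ1.le) (hξ2.le.trans h2)
          (show -2 ≤ α - 2 by linarith) (by linarith)
        rw [he]
        have hp : 0 < h * α * (α - 1) * θ := by positivity
        constructor
        · calc lam * h = h * α * (α - 1) * θ * ((N : ℝ) ^ (α - 2) / 25) := by rw [hlam]; ring
            _ ≤ h * α * (α - 1) * θ * ξ ^ (α - 2) := mul_le_mul_of_nonneg_left hc.1 hp.le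
            _ = _ := by ring
        · calc h * (α * ((α - 1) * ξ ^ (α - 2))) * θ = h * α * (α - 1) * θ * ξ ^ (α - 2) := by ring
            _ ≤ h * α * (α - 1) * θ * (5 * (N : ℝ) ^ (α - 2)) :=
              mul_le_mul_of_nonneg_left hc.2 hp.le
            _ = _ := by rw [hlam]; ring
      have hhL' : 125 * lam * h ≤ 1 / 2 := by
        have : (h : ℝ) ≤ L := by exact_mod_cast hhL.le
        nlinarith
      have hk := norm_sum_ee_le_of_monotone_diff
        (φ := fun i => ((s + (i + h) : ℕ) : ℝ) ^ α * θ - ((s + i : ℕ) : ℝ) ^ α * θ)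
        (M := m - h) (lam := lam * h) (by positivity)
        (fun i hi => by
          have := (hb i hi).1
          simp only [(hcast i).1, (hcast i).2.1, (hcast i).2.2.2.1]
          linarith)
        (fun i hi => by
          have := (hb i hi).2
          simp only [(hcast i).1, (hcast i).2.1, (hcast i).2.2.2.1]
          linarith)
        (Or.inr fun i hi => by
          have h1 : (0 : ℝ) < ((s + i : ℕ) : ℝ) := by exact_mod_cast (by omega : 0 < s + i)
          have := mul_le_mul_of_nonneg_right
            (rpow_mixed_diff_antitone hα1.le hα2.le h1 hhR) hθ.le
          simp only [(hcast i).1, (hcast i).2.1, (hcast i).2.2.1, (hcast i).2.2.2.1,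
            (hcast i).2.2.2.2]
          linarith)
      refine hk.trans_eq ?_
      field_simp
  refine (sum_le_sum hterm).trans ?_
  rw [sum_add_distrib, ← mul_sum]
  refine add_le_add ?_ ?_
  · rw [sum_ite_eq' (range L) 0]
    split_ifs
    · exact le_rfl
    · positivity
  · calc 2 / lam * ∑ h ∈ range L, (1 : ℝ) / h ≤ 2 / lam * (3 * √L) :=
          mul_le_mul_of_nonneg_left (sum_one_div_le_sqrt L) (by positivity)
      _ = _ := by ring

/-- Pieces of length `L` of order `1 / lam` have sums `O(L ^ (3 / 4))`, so the block sum is `O(N * L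
^ (-1 / 4) + L ^ (3 / 4))`. Here `θ ≤ B` gives `L ≫ N ^ (2 - α)`, and large increments give `L ≪ N`.
-/
theorem exists_rpow_fast_bound {α B : ℝ} (hα1 : 1 < α) (hα2 : α < 2) (hB : 0 < B) :
    ∃ C : ℝ, 0 < C ∧ ∃ N₀ : ℕ, ∀ (θ : ℝ) (N M : ℕ), 0 < θ → θ ≤ B → N₀ ≤ N → M ≤ 3 * N →
      1 < 10 * α * θ * (N : ℝ) ^ (α - 1) →
      ‖∑ k ∈ range M, ee (((N + k : ℕ) : ℝ) ^ α * θ)‖ ≤ N * (C * (N : ℝ) ^ (-((2 - α) / 4))) := by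
  have hα' : 0 < α - 1 := by linarith
  have hα'' : 0 < 2 - α := by linarith
  have htend : Tendsto (fun N : ℕ => (N : ℝ) ^ (2 - α)) atTop atTop :=
    (tendsto_rpow_atTop hα'').comp tendsto_natCast_atTop_atTop
  obtain ⟨N₁, hN₁⟩ := eventually_atTop.1
    (htend.eventually (eventually_ge_atTop (10 * B * (α * (α - 1)))))
  set c : ℝ := 1 / (20 * B * (α * (α - 1))) with hc
  have hc0 : 0 < c := by positivity
  refine ⟨240 * c ^ (-(1 / 4) : ℝ) + 80 * (1 / (α - 1)) ^ (3 / 4 : ℝ), by positivity, N₁ + 1,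
    fun θ N M hθ hθB hN hM hfast => ?_⟩
  have hN0 : 0 < N := by omega
  have hNR : (0 : ℝ) < N := by exact_mod_cast hN0
  have hN1 : (1 : ℝ) ≤ N := by exact_mod_cast hN0
  have hp0 : (0 : ℝ) < (N : ℝ) ^ (2 - α) := by positivity
  have hpinv : (N : ℝ) ^ (α - 2) = 1 / (N : ℝ) ^ (2 - α) := by
    rw [show α - 2 = -(2 - α) by ring, Real.rpow_neg hNR.le, one_div]
  set lam : ℝ := θ * (α * ((α - 1) * ((N : ℝ) ^ (α - 2) / 25))) with hlam
  have hlam0 : 0 < lam := by positivity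
  have hlamB : 250 * lam ≤ 10 * B * (α * (α - 1)) / (N : ℝ) ^ (2 - α) := by
    have : 250 * lam = 10 * θ * (α * (α - 1)) / (N : ℝ) ^ (2 - α) := by
      rw [hlam, hpinv]; ring
    rw [this]
    gcongr
  have hlam1 : 250 * lam ≤ 1 := by
    refine hlamB.trans ?_
    rw [div_le_one hp0]
    exact hN₁ N (by omega)
  set L : ℕ := ⌊1 / (250 * lam)⌋₊ with hL
  have hL1 : 1 ≤ L := by
    rw [hL, Nat.one_le_floor_iff, one_le_div (by positivity)]
    exact hlam1
  have hLR : (1 : ℝ) ≤ L := by exact_mod_cast hL1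
  have hLle : (L : ℝ) ≤ 1 / (250 * lam) := Nat.floor_le (by positivity)
  have hLge : 1 / (250 * lam) ≤ 2 * L := by
    have := Nat.lt_floor_add_one (1 / (250 * lam))
    rw [← hL] at this
    linarith
  have hL250 : 250 * lam * L ≤ 1 := by
    rw [le_div_iff₀ (by positivity)] at hLle
    linarith
  have hlaminv : 1 / lam ≤ 500 * L := by
    have : 1 / lam = 250 * (1 / (250 * lam)) := by field_simp
    rw [this]; linarith
  set W : ℝ := 80 * (L : ℝ) ^ (3 / 4 : ℝ) with hW
  have hpiece : ∀ s m, m ≤ L → s + m ≤ M →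
      ‖∑ i ∈ range m, ee (((N + (s + i) : ℕ) : ℝ) ^ α * θ)‖ ≤ W := by
    intro s m hm hsm
    have h1 := norm_sq_sum_rpow_short_le (s := N + s) hα1 hα2 hθ hN0 (by omega) (by omega) hm
      hlam hL250
    have h2 : W ^ 2 = 6400 * (L * √L) := by
      have h3 : (L : ℝ) * √L = (L : ℝ) ^ ((3 / 4 : ℝ) + 3 / 4) := by
        rw [Real.sqrt_eq_rpow]
        nth_rewrite 1 [← Real.rpow_one (L : ℝ)]
        rw [← Real.rpow_add (by linarith)]
        norm_num
      rw [h3, Real.rpow_add (by linarith), hW]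
      ring
    refine le_of_sq_le_sq (le_trans ?_ h2.ge) (by positivity)
    simp only [← add_assoc]
    refine h1.trans ?_
    have hs1 : 1 ≤ √(L : ℝ) := Real.one_le_sqrt.2 hLR
    have h4 : 6 * √(L : ℝ) / lam ≤ 3000 * (L * √L) := by
      calc 6 * √(L : ℝ) / lam = 6 * √L * (1 / lam) := by ring
        _ ≤ 6 * √L * (500 * L) := by gcongr
        _ = _ := by ring
    have h5 : (L : ℝ) ≤ L * √L := le_mul_of_one_le_right (by linarith) hs1
    linarith
  have hsum := norm_sum_le_of_pieces (a := fun k => ee (((N + k : ℕ) : ℝ) ^ α * θ)) hL1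
    (W := W) (by positivity) M hpiece
  refine hsum.trans ?_
  have hLpos : (0 : ℝ) < L := by linarith
  have hMR : (M : ℝ) ≤ 3 * N := by exact_mod_cast hM
  have hLlow : c * (N : ℝ) ^ (2 - α) ≤ L := by
    have h1 : c * (N : ℝ) ^ (2 - α) = 1 / (2 * (10 * B * (α * (α - 1)) / (N : ℝ) ^ (2 - α))) := by
      rw [hc]; field_simp; norm_num
    rw [h1]
    calc 1 / (2 * (10 * B * (α * (α - 1)) / (N : ℝ) ^ (2 - α))) ≤ 1 / (2 * (250 * lam)) :=
          one_div_le_one_div_of_le (by positivity) (by linarith)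
      _ = 1 / (250 * lam) / 2 := by field_simp
      _ ≤ L := by linarith
  have hLup : (L : ℝ) ≤ 1 / (α - 1) * N := by
    refine hLle.trans ?_
    have h1 : (N : ℝ) ^ (α - 1) = (N : ℝ) ^ (α - 2) * N := by
      rw [show α - 2 = α - 1 - 1 by ring, Real.rpow_sub_one hNR.ne' (α - 1),
        div_mul_cancel₀ _ hNR.ne']
    have h2 : α - 1 ≤ 250 * lam * N := by
      rw [h1] at hfast
      have := mul_le_mul_of_nonneg_left hfast.le hα'.le
      calc α - 1 = (α - 1) * 1 := (mul_one _).symm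
        _ ≤ _ := this
        _ = _ := by rw [hlam]; ring
    rw [one_div_mul_eq_div, div_le_div_iff₀ (by positivity) hα']
    linarith
  have hterm1 : (L : ℝ) ^ (-(1 / 4) : ℝ) ≤ c ^ (-(1 / 4) : ℝ) * (N : ℝ) ^ (-((2 - α) / 4)) := by
    calc (L : ℝ) ^ (-(1 / 4) : ℝ) ≤ (c * (N : ℝ) ^ (2 - α)) ^ (-(1 / 4) : ℝ) :=
          Real.rpow_le_rpow_of_nonpos (by positivity) hLlow (by norm_num)
      _ = _ := by
        rw [Real.mul_rpow hc0.le hp0.le, ← Real.rpow_mul hNR.le]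
        congr 2
        ring
  have hterm2 : (L : ℝ) ^ (3 / 4 : ℝ) ≤
      (1 / (α - 1)) ^ (3 / 4 : ℝ) * (N * (N : ℝ) ^ (-((2 - α) / 4))) := by
    calc (L : ℝ) ^ (3 / 4 : ℝ) ≤ (1 / (α - 1) * N) ^ (3 / 4 : ℝ) := by gcongr
      _ = (1 / (α - 1)) ^ (3 / 4 : ℝ) * (N : ℝ) ^ (3 / 4 : ℝ) :=
        Real.mul_rpow (by positivity) hNR.le
      _ ≤ (1 / (α - 1)) ^ (3 / 4 : ℝ) * (N : ℝ) ^ (1 + -((2 - α) / 4)) := by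
        gcongr
        linarith
      _ = _ := by rw [Real.rpow_add hNR, Real.rpow_one]
  have hLL : (L : ℝ) ^ (3 / 4 : ℝ) / L = (L : ℝ) ^ (-(1 / 4) : ℝ) := by
    rw [← Real.rpow_sub_one hLpos.ne']; norm_num
  calc ((M : ℝ) / L + 1) * W ≤ (3 * N / L + 1) * W := by gcongr
    _ = 240 * N * ((L : ℝ) ^ (3 / 4 : ℝ) / L) + 80 * (L : ℝ) ^ (3 / 4 : ℝ) := by rw [hW]; ring
    _ ≤ 240 * N * (c ^ (-(1 / 4) : ℝ) * (N : ℝ) ^ (-((2 - α) / 4))) +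
        80 * ((1 / (α - 1)) ^ (3 / 4 : ℝ) * (N * (N : ℝ) ^ (-((2 - α) / 4)))) := by
      rw [hLL]; gcongr
    _ = _ := by ring

theorem exists_rpow_block_bound {α B : ℝ} (hα0 : 0 < α) (hα2 : α < 2) (hα1 : α ≠ 1)
    (hB : 0 < B) :
    ∃ C κ : ℝ, 0 < C ∧ 0 < κ ∧ ∃ N₀ : ℕ, ∀ (θ : ℝ) (N M : ℕ), 0 ≤ θ → θ ≤ B → N₀ ≤ N →
      M ≤ 3 * N → |∑ k ∈ range M, Real.sin (2 * Real.pi * (((N + k : ℕ) : ℝ) ^ α * θ))| ≤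
        N * (C * min ((N : ℝ) ^ α * θ) (1 / ((N : ℝ) ^ α * θ)) + C * (N : ℝ) ^ (-κ)) := by
  have hpi := Real.pi_pos
  obtain ⟨Cf, κ, hCf, hκ, N₁, hN₁⟩ : ∃ C κ : ℝ, 0 < C ∧ 0 < κ ∧ ∃ N₀ : ℕ, ∀ (θ : ℝ) (N M : ℕ),
      0 < θ → θ ≤ B → N₀ ≤ N → M ≤ 3 * N → 1 < 10 * α * θ * (N : ℝ) ^ (α - 1) →
      ‖∑ k ∈ range M, ee (((N + k : ℕ) : ℝ) ^ α * θ)‖ ≤ N * (C * (N : ℝ) ^ (-κ)) := by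
    rcases lt_or_gt_of_ne hα1 with h | h
    · have htend : Tendsto (fun N : ℕ => (N : ℝ) ^ (1 - α)) atTop atTop :=
        (tendsto_rpow_atTop (by linarith)).comp tendsto_natCast_atTop_atTop
      obtain ⟨N₁, hN₁⟩ := eventually_atTop.1
        (htend.eventually (eventually_ge_atTop (10 * α * B)))
      refine ⟨1, 1, one_pos, one_pos, N₁ + 1, fun θ N M hθ hθB hN _ hfast => ?_⟩
      -- For `α < 1` the increments tend to 0 uniformly in `θ ≤ B`, so large `N` never meets the
      -- fast case.
      exfalso
      have hNR : (0 : ℝ) < N := by exact_mod_cast (by omega : 0 < N)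
      have hp0 : (0 : ℝ) < (N : ℝ) ^ (1 - α) := by positivity
      rw [show α - 1 = -(1 - α) by ring, Real.rpow_neg hNR.le, ← div_eq_mul_inv,
        one_lt_div hp0] at hfast
      have h1 := hN₁ N (by omega)
      have : 10 * α * θ ≤ 10 * α * B := by gcongr
      linarith
    · obtain ⟨C, hC, N₀, hh⟩ := exists_rpow_fast_bound h hα2 hB
      exact ⟨C, (2 - α) / 4, hC, by linarith, N₀, hh⟩
  refine ⟨6 * Real.pi * 4 ^ α + 50 / α + Cf, κ, by positivity, hκ, N₁ + 1,
    fun θ N M hθ0 hθB hN hM => ?_⟩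
  have hN0 : 0 < N := by omega
  have hNR : (0 : ℝ) < N := by exact_mod_cast hN0
  have hp1 : 0 < 6 * Real.pi * (4 : ℝ) ^ α := by positivity
  have hp2 : 0 < 50 / α := by positivity
  set C := 6 * Real.pi * 4 ^ α + 50 / α + Cf with hC
  have hC0 : 0 < C := by positivity
  have hmin0 : 0 ≤ min ((N : ℝ) ^ α * θ) (1 / ((N : ℝ) ^ α * θ)) := by positivity
  have hκ0 : 0 ≤ C * (N : ℝ) ^ (-κ) := by positivity
  have htriv : |∑ k ∈ range M, Real.sin (2 * Real.pi * (((N + k : ℕ) : ℝ) ^ α * θ))| ≤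
      N * (C * ((N : ℝ) ^ α * θ)) := by
    have hterm : ∀ k ∈ range M, |Real.sin (2 * Real.pi * (((N + k : ℕ) : ℝ) ^ α * θ))| ≤
        2 * Real.pi * ((4 * N) ^ α * θ) := by
      intro k hk
      rw [mem_range] at hk
      have hk' : ((N + k : ℕ) : ℝ) ≤ 4 * N := by exact_mod_cast (by omega : N + k ≤ 4 * N)
      refine Real.abs_sin_le_abs.trans ?_
      rw [abs_of_nonneg (by positivity)]
      gcongr
    refine (abs_sum_le_sum_abs _ _).trans ((sum_le_sum hterm).trans ?_)
    rw [sum_const, card_range, nsmul_eq_mul, Real.mul_rpow (by norm_num) hNR.le]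
    have hMR : (M : ℝ) ≤ 3 * N := by exact_mod_cast hM
    calc (M : ℝ) * (2 * Real.pi * (4 ^ α * (N : ℝ) ^ α * θ))
        ≤ (3 * N) * (2 * Real.pi * (4 ^ α * (N : ℝ) ^ α * θ)) := by gcongr
      _ = N * ((6 * Real.pi * 4 ^ α) * ((N : ℝ) ^ α * θ)) := by ring
      _ ≤ _ := by gcongr; linarith
  rcases hθ0.eq_or_lt with h0 | hθ
  · rw [← h0] at htriv ⊢
    simp only [mul_zero] at htriv ⊢
    refine htriv.trans ?_
    simp only [div_zero, min_self, mul_zero, zero_add]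
    positivity
  have him : |∑ k ∈ range M, Real.sin (2 * Real.pi * (((N + k : ℕ) : ℝ) ^ α * θ))| ≤
      ‖∑ k ∈ range M, ee (((N + k : ℕ) : ℝ) ^ α * θ)‖ := by
    refine le_trans (le_of_eq ?_) (Complex.abs_im_le_norm _)
    rw [Complex.im_sum]
    simp only [ee_im]
  rcases le_or_gt (10 * α * θ * (N : ℝ) ^ (α - 1)) 1 with hslow | hfast
  · have hKL := him.trans (norm_sum_rpow_le_of_slow hα0 hα2 hθ hN0 hM hslow)
    have hmin : |∑ k ∈ range M, Real.sin (2 * Real.pi * (((N + k : ℕ) : ℝ) ^ α * θ))| ≤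
        N * (C * min ((N : ℝ) ^ α * θ) (1 / ((N : ℝ) ^ α * θ))) := by
      rcases min_choice ((N : ℝ) ^ α * θ) (1 / ((N : ℝ) ^ α * θ)) with h | h
      · rw [h]; exact htriv
      · rw [h]
        refine hKL.trans ?_
        gcongr
        linarith
    refine hmin.trans ?_
    gcongr
    linarith
  · refine (him.trans (hN₁ θ N M hθ hθB (by omega) hM hfast)).trans ?_
    have h1 : Cf * (N : ℝ) ^ (-κ) ≤ C * (N : ℝ) ^ (-κ) := by gcongr; linarith
    have h2 : 0 ≤ C * min ((N : ℝ) ^ α * θ) (1 / ((N : ℝ) ^ α * θ)) := by positivity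
    gcongr
    linarith

theorem BlockBounded.neg {j₀ : ℕ} {C : ℝ} {v : ℕ → ℝ} (h : BlockBounded j₀ C v) :
    BlockBounded j₀ C fun n => -v n := by
  obtain ⟨T, h0, h1, h2⟩ := h
  refine ⟨T, h0, fun j hj M hM => ?_, h2⟩
  rw [sum_neg_distrib, abs_neg]
  exact h1 j hj M hM

theorem exists_blockBounded_rpow {α : ℝ} (hα0 : 0 < α) (hα2 : α < 2) {B : ℝ} (hB : 0 < B) :
    ∃ (j₀ : ℕ) (C : ℝ), ∀ x : ℝ, |x| ≤ B → BlockBounded j₀ C fun n =>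
      Real.sin ((n : ℝ) ^ α * x) := by
  have hpi := Real.pi_pos
  rcases eq_or_ne α 1 with rfl | hα1
  · refine ⟨0, 24 * Real.pi * (2 * (4 + 1) / (4 - 1)), fun x _ => ?_⟩
    have h3 : (fun n : ℕ => Real.sin ((n : ℝ) ^ (1 : ℝ) * x)) = fun n : ℕ =>
        Real.sin (2 * Real.pi * (n * (x / (2 * Real.pi)))) := by
      funext n
      rw [Real.rpow_one]
      congr 1
      field_simp
    rw [h3]
    exact blockBounded_linear _
  obtain ⟨C, κ, hC, hκ, N₀, h⟩ := exists_rpow_block_bound hα0 hα2 hα1 hB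
  set z : ℝ := (4 : ℝ) ^ (-κ) with hz
  have hz0 : 0 < z := by positivity
  have hz1 : z < 1 := Real.rpow_lt_one_of_one_lt_of_neg (by norm_num) (by linarith)
  have hρ : (1 : ℝ) < 4 ^ α := Real.one_lt_rpow (by norm_num) hα0
  have hpos : ∀ θ : ℝ, 0 ≤ θ → θ ≤ B →
      BlockBounded N₀ (C * (2 * (4 ^ α + 1) / (4 ^ α - 1)) + C * (1 - z)⁻¹) fun n =>
        Real.sin (2 * Real.pi * ((n : ℝ) ^ α * θ)) := by
    intro θ hθ0 hθB
    refine ⟨fun j => C * min (((4 : ℝ) ^ α) ^ j * θ) (1 / (((4 : ℝ) ^ α) ^ j * θ)) + C * z ^ j,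
      fun j => by positivity, fun j hj M hM => ?_, fun J => ?_⟩
    · have h1 := h θ (4 ^ j) M hθ0 hθB (by
        have := Nat.lt_pow_self (show 1 < 4 by norm_num) (n := j)
        omega) hM
      have hpow : ∀ s : ℝ, (((4 ^ j : ℕ) : ℝ)) ^ s = ((4 : ℝ) ^ s) ^ j := by
        intro s
        push_cast
        rw [← Real.rpow_natCast, ← Real.rpow_natCast, ← Real.rpow_mul (by norm_num),
          ← Real.rpow_mul (by norm_num), mul_comm]
      rw [hpow, hpow] at h1
      refine h1.trans_eq ?_
      push_cast
      rfl
    · rw [sum_add_distrib, ← mul_sum, ← mul_sum]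
      exact add_le_add
        (mul_le_mul_of_nonneg_left (sum_min_geometric_le hρ hθ0 J) hC.le)
        (mul_le_mul_of_nonneg_left (sum_pow_le hz0.le hz1 J) hC.le)
  refine ⟨N₀, C * (2 * (4 ^ α + 1) / (4 ^ α - 1)) + C * (1 - z)⁻¹, fun x hx => ?_⟩
  have hb := hpos (|x| / (2 * Real.pi)) (by positivity) (by
    rw [div_le_iff₀ (by positivity)]
    nlinarith [Real.pi_gt_three])
  have heq : (fun n : ℕ => Real.sin (2 * Real.pi * ((n : ℝ) ^ α * (|x| / (2 * Real.pi))))) =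
      fun n : ℕ => Real.sin ((n : ℝ) ^ α * |x|) := by
    funext n
    congr 1
    field_simp
  rw [heq] at hb
  rcases abs_cases x with ⟨hx', -⟩ | ⟨hx', -⟩
  · rwa [hx'] at hb
  · rw [hx'] at hb
    have := hb.neg
    simpa only [mul_neg, Real.sin_neg, neg_neg] using this

end ExpSum

/-! ### The theorem. -/

open ExpSum

theorem theorem1 (c : ℕ → ℝ) (hc_nonneg : ∀ k : ℕ, 1 ≤ k → 0 ≤ c k)
    (hc_anti : AntitoneOn c (Set.Ici 1)) :
    -- (a)
    (∀ α : ℕ, 0 < α → Even α →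
      (SeriesConverges (fun k => c k * Real.sin ((k : ℝ) ^ α * (Real.pi / 2))) ∨
        SeriesConverges (fun k => c k * Real.sin ((k : ℝ) ^ α * (2 * Real.pi / 3)))) →
      SeriesConverges c) ∧
    -- (b)
    (∀ α : ℕ, Odd α → ∀ f : Polynomial ℚ, f.natDegree = α → (∀ j : ℕ, Even j → f.coeff j = 0) →
      Filter.Tendsto (fun k : ℕ => c k * (k : ℝ)) Filter.atTop (nhds 0) →
      SeriesConvergesUniformlyOn
        (fun k x => c k * Real.sin (((f.eval (k : ℚ) : ℚ) : ℝ) * x)) Set.univ) ∧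
    -- (c)
    (∀ α : ℝ, 0 < α → α < 2 →
      Filter.Tendsto (fun k : ℕ => c k * (k : ℝ)) Filter.atTop (nhds 0) →
      ∀ S : Set ℝ, Bornology.IsBounded S →
        SeriesConvergesUniformlyOn (fun k x => c k * Real.sin ((k : ℝ) ^ α * x)) S) := by
  refine ⟨fun α hα hev h => ?_, fun α hα f hdeg hf hck => ?_, fun α hα0 hα2 hck S hS => ?_⟩
  · rcases h with h | h
    · simp only [sin_pow_mul_pi_div_two hα hev] at h
      refine seriesConverges_of_weighted hc_nonneg hc_anti le_rfl (fun k => ?_) (fun k hk => ?_) h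
      · split_ifs <;> norm_num
      · rw [if_neg hk]; norm_num
    · simp only [sin_pow_mul_two_pi_div_three hα hev] at h
      refine seriesConverges_of_weighted hc_nonneg hc_anti (p := 3) (by norm_num) (fun k => ?_)
        (fun k hk => ?_) h
      · split_ifs <;> positivity
      · rw [if_neg hk]
        have : 1 ≤ √(3 : ℝ) := Real.one_le_sqrt.2 (by norm_num)
        linarith
  · obtain ⟨j₀, C, hB⟩ := exists_blockBounded_rat (f := f) (by rwa [hdeg]) hf
    exact seriesConvergesUniformlyOn_of_blocks hc_nonneg hc_anti hck
      (fun k x => Real.sin (((f.eval (k : ℚ) : ℚ) : ℝ) * x)) Set.univ j₀ C fun x _ => hB x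
  · obtain ⟨B, hB⟩ := isBounded_iff_forall_norm_le.1 hS
    -- The norm bound `B` may be nonpositive, for instance when `S` is empty; `|B| + 1` is a
    -- positive bound in every case.
    obtain ⟨j₀, C, hBl⟩ := exists_blockBounded_rpow hα0 hα2 (B := |B| + 1) (by positivity)
    refine seriesConvergesUniformlyOn_of_blocks hc_nonneg hc_anti hck
      (fun k x => Real.sin ((k : ℝ) ^ α * x)) S j₀ C fun x hx => hBl x ?_
    have h1 := hB x hx
    rw [Real.norm_eq_abs] at h1
    linarith [le_abs_self B]
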